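/- Fix $t\in[0,1)$. **Vertex weights.** For $i,j,k,l\in\{0,1\}$ (the numbers of lines at the bottom, left, top and right of a vertex) let $\mathsf L^1(1,1;1,1)=t$, $\mathsf L^1(1,1;0,0)=1-t$, $\mathsf L^1(1,0;1,0)=\mathsf L^1(0,1;0,1)=\mathsf L^1(0,0;0,0)=1$, and $\mathsf L^1=0$ otherwise. Colors are integers; a color with a smaller label has higher priority. For a finite set $a$ of colors and a color $r$ put $\mathfrak s_r(a)=\#\{c\in a: c\le r\}\bmod 2$. For a finite set $S$ of colors and $a,b,k,l\subseteq S$ (the colors of the lines at the bottom, left, top and right) let $$\mathsf L^S(a,b;k,l)=\mathfrak{min}_{r\in S}\ \mathsf L^1\big(\mathfrak s_r(a),\mathfrak s_r(b);\mathfrak s_r(k),\mathfrak s_r(l)\big),$$ where $\mathfrak{min}$ is $0$ if both values $t$ and $1-t$ (regarded as indeterminates) occur, and is the minimum otherwise (and is $1$ if $S=\emptyset$). **The step colored $t$-PNG model.** Let the nucleations form a Poisson point process of density $1$ on $(0,\infty)^2$. A nucleation in $[m,m+1]\times[n,n+1]$ ($m,n\in\mathbb Z_{\ge0}$) has color $-\min(m+1,n+1)$;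 from it one line of this color goes up and one goes to the right. Given the nucleations, when the vertical lines traveling together with color set $a$ (coming from below) meet the horizontal lines traveling together with color set $b$ (coming from the left), the color sets $k$ and $l$ of the lines that leave the intersection point upward and to the right are sampled with probability $\mathsf L^{a\cup b}(a,b;k,l)$, independently at different intersection points. For integers $0\le m\le n$ let $H_{m,n}$ be the set of points at which the segment $[m,n]\times\{n\}$ meets vertical lines of the model (lines traveling together give one point), let $v_z^{[m,n]}$ be the number of vertical lines through $z$ with colors in $\{-n,\dots,-m-1\}$, and $$X_{m,n}=\sum_{z\in H_{m,n}}\big(v_z^{[m,n]}\bmod 2\big).$$ **Proposition.** The $X_{m,n}$ are random variables that satisfy the hypotheses of Liggett's superadditive ergodic theorem: 1. almost surely, $X_{0,0}=0$ and $X_{0,n}\ge X_{0,m}+X_{m,n}$ for all $0\le m\le n$; 2. for each $k\ge1$, the process $\{X_{(n-1)k,nk}: n\ge1\}$ is ergodic (its law on sequence space is invariant and ergodic under the shift); 3. for each $m\ge0$, $\{X_{m,m+k}:k\ge0\}\overset d=\{X_{m+1,m+k+1}:k\ge0\}$; 4. $\mathbb E[X_{0,1}^-]<\infty$, where $x^-=\max(-x,0)$.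 -/

import Mathlib

open MeasureTheory ProbabilityTheory

namespace TPNG

/-! ### The vertex weights -/

/-- The four values `0`, `t`, `1 - t`, `1` of vertex weights, with `t` and `1 - t` regarded as
indeterminates (so that they are distinct from each other and from `0` and `1`). -/
inductive Weight
  | zero
  | tt
  | oneSubT
  | one
  deriving DecidableEq

/-- The real number denoted by a symbolic weight. -/
def Weight.val (t : ℝ) : Weight → ℝ
  | .zero => 0
  | .tt => t
  | .oneSubT => 1 - t
  | .one => 1

/-- The single-colored matrix: `L1 i j k l` is the weight of a vertex with `i`, `j`, `k`, `l` lines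
on its bottom, left, top and right, respectively (each number being `0` or `1`). -/
def L1 : ℕ → ℕ → ℕ → ℕ → Weight
  | 1, 1, 1, 1 => .tt
  | 1, 1, 0, 0 => .oneSubT
  | 1, 0, 1, 0 => .one
  | 0, 1, 0, 1 => .one
  | 0, 0, 0, 0 => .one
  | _, _, _, _ => .zero

/-- The modified minimum of a finite set of weights: it is `0` if both `t` and `1 - t` occur, and
the usual minimum (for `0 ≤ t ≤ 1`) otherwise. -/
def modMin (W : Finset Weight) : Weight :=
  if .tt ∈ W ∧ .oneSubT ∈ W then .zero
  else if .zero ∈ W then .zero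
  else if .tt ∈ W then .tt
  else if .oneSubT ∈ W then .oneSubT
  else .one

/-- The `r`-fold projection of a set `a` of (pairwise distinct) colors traveling together: the
number, modulo `2`, of colors in `a` whose label is at most `r`. Smaller labels have higher
priority. -/
def proj (r : ℤ) (a : Finset ℤ) : ℕ := (a.filter (· ≤ r)).card % 2

/-- The entry `L(a, b; k, l)` of the stochastic matrix for the finite set of colors `S`, where
`a`, `b`, `k`, `l ⊆ S` are the sets of colors of the lines on the bottom, left, top and right of the
vertex: the modified minimum over `r ∈ S` of the weights of the `r`-fold projections. For
`S = {1, …, n}`, identifying `{0,1}^n` with the subsets of `S`, this is the `n`-colored matrix. -/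
noncomputable def L (t : ℝ) (S a b k l : Finset ℤ) : ℝ :=
  (modMin (S.image fun r => L1 (proj r a) (proj r b) (proj r k) (proj r l))).val t

/-! ### The deterministic dynamics, given nucleations and vertex outcomes

The nucleations are enumerated as points `p 0, p 1, …` of the plane. The line going up from `p i`
lies on the vertical axis `x = (p i).1`, the line going right from `p j` on the horizontal axis
`y = (p j).2`. Lines never leave these axes, so every intersection point is of the form
`((p i).1, (p j).2)` with `(p j).1 < (p i).1` and `(p i).2 < (p j).2`; it is labeled by `(i, j)`.
The outcome at the vertex `(i, j)`, for input color sets `a` (from the bottom) and `b` (from the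
left), is `ξ (i, j) a b = (k, l)`, with `k` the colors leaving upward and `l` those leaving to the
right. -/

/-- The color of a nucleation at `z`: it is `-min (m + 1) (n + 1)` on `[m, m+1] × [n, n+1]`. -/
noncomputable def color (z : ℝ × ℝ) : ℤ := -min (⌊z.1⌋ + 1) (⌊z.2⌋ + 1)

/-- The index `j` of the last horizontal axis met by the vertical line of `p i` strictly below
height `s` (with `j = i` if there is none above `p i` itself): `p j` is the highest of the points
with `x`-coordinate at most `(p i).1` and `y`-coordinate in `[(p i).2, s)`. -/
noncomputable def lastBelow (p : ℕ → ℝ × ℝ) (i : ℕ) (s : ℝ) : ℕ :=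
  sInf {j | ((p j).1 ≤ (p i).1 ∧ (p i).2 ≤ (p j).2 ∧ (p j).2 < s) ∧
    ∀ k, (p k).1 ≤ (p i).1 → (p i).2 ≤ (p k).2 → (p k).2 < s → (p k).2 ≤ (p j).2}

/-- The index `i` of the last vertical axis met by the horizontal line of `p j` strictly to the left
of abscissa `s` (with `i = j` if there is none to the right of `p j` itself). -/
noncomputable def lastLeft (p : ℕ → ℝ × ℝ) (j : ℕ) (s : ℝ) : ℕ :=
  sInf {i | ((p i).2 ≤ (p j).2 ∧ (p j).1 ≤ (p i).1 ∧ (p i).1 < s) ∧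
    ∀ k, (p k).2 ≤ (p j).2 → (p j).1 ≤ (p k).1 → (p k).1 < s → (p k).1 ≤ (p i).1}

/-- The nucleations in the closed lower-left quadrant with corner `((p i).1, (p j).2)`. -/
def lowerLeft (p : ℕ → ℝ × ℝ) (i j : ℕ) : Set ℕ := {k | (p k).1 ≤ (p i).1 ∧ (p k).2 ≤ (p j).2}

theorem lastBelow_spec {p : ℕ → ℝ × ℝ} {i j : ℕ} (hy : (p i).2 < (p j).2)
    (hf : (lowerLeft p i j).Finite) :
    (p (lastBelow p i (p j).2)).2 < (p j).2 := by
  have hne : {j' | ((p j').1 ≤ (p i).1 ∧ (p i).2 ≤ (p j').2 ∧ (p j').2 < (p j).2) ∧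
      ∀ k, (p k).1 ≤ (p i).1 → (p i).2 ≤ (p k).2 → (p k).2 < (p j).2 →
        (p k).2 ≤ (p j').2}.Nonempty := by
    have hA : {k | (p k).1 ≤ (p i).1 ∧ (p i).2 ≤ (p k).2 ∧ (p k).2 < (p j).2}.Finite :=
      hf.subset fun k hk => ⟨hk.1, hk.2.2.le⟩
    obtain ⟨a, ha, hmax⟩ := Set.exists_max_image _ (fun k => (p k).2) hA ⟨i, le_rfl, le_rfl, hy⟩
    exact ⟨a, ha, fun k h1 h2 h3 => hmax k ⟨h1, h2, h3⟩⟩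
  exact (Nat.sInf_mem hne).1.2.2

theorem lastLeft_spec {p : ℕ → ℝ × ℝ} {i j : ℕ} (hx : (p j).1 < (p i).1)
    (hf : (lowerLeft p i j).Finite) :
    (p (lastLeft p j (p i).1)).1 < (p i).1 := by
  have hne : {i' | ((p i').2 ≤ (p j).2 ∧ (p j).1 ≤ (p i').1 ∧ (p i').1 < (p i).1) ∧
      ∀ k, (p k).2 ≤ (p j).2 → (p j).1 ≤ (p k).1 → (p k).1 < (p i).1 →
        (p k).1 ≤ (p i').1}.Nonempty := by
    have hA : {k | (p k).2 ≤ (p j).2 ∧ (p j).1 ≤ (p k).1 ∧ (p k).1 < (p i).1}.Finite :=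
      hf.subset fun k hk => ⟨hk.2.2.le, hk.1⟩
    obtain ⟨a, ha, hmax⟩ := Set.exists_max_image _ (fun k => (p k).1) hA ⟨j, le_rfl, le_rfl, hx⟩
    exact ⟨a, ha, fun k h1 h2 h3 => hmax k ⟨h1, h2, h3⟩⟩
  exact (Nat.sInf_mem hne).1.2.2

open Classical in
/-- `lines p ξ i j = (k, l)`, where `k` and `l` are the sets of colors of the lines that leave the
point `((p i).1, (p j).2)` upward and to the right, respectively. At a nucleation (`i = j`) one line
of the color of that nucleation leaves in each direction. At a vertex `(i, j)`, the lines entering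
from the bottom are those that left the preceding vertex (or the nucleation) on the vertical axis of
`p i`, the lines entering from the left are those that left the preceding vertex (or the nucleation)
on the horizontal axis of `p j`, and the outcome is read off from `ξ`. (The finiteness condition
holds for every locally finite configuration in the quadrant.) -/
noncomputable def lines (p : ℕ → ℝ × ℝ)
    (ξ : ℕ × ℕ → Finset ℤ → Finset ℤ → Finset ℤ × Finset ℤ) (i j : ℕ) : Finset ℤ × Finset ℤ :=
  if _h : (p j).1 < (p i).1 ∧ (p i).2 < (p j).2 ∧ (lowerLeft p i j).Finite then
    ξ (i, j) (lines p ξ i (lastBelow p i (p j).2)).1 (lines p ξ (lastLeft p j (p i).1) j).2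
  else if i = j then ({color (p i)}, {color (p i)})
  else (∅, ∅)
termination_by (lowerLeft p i j).ncard
decreasing_by
  · obtain ⟨hx, hy, hf⟩ := _h
    have h := lastBelow_spec hy hf
    refine Set.ncard_lt_ncard ⟨fun k hk => ⟨hk.1, hk.2.trans h.le⟩, fun hs => ?_⟩ hf
    have h2 : j ∈ lowerLeft p i j := ⟨hx.le, le_rfl⟩
    exact absurd (hs h2).2 (not_le.mpr h)
  · obtain ⟨hx, hy, hf⟩ := _h
    have h := lastLeft_spec hx hf
    refine Set.ncard_lt_ncard ⟨fun k hk => ⟨hk.1.trans h.le, hk.2⟩, fun hs => ?_⟩ hf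
    have h2 : i ∈ lowerLeft p i j := ⟨le_rfl, hy.le⟩
    exact absurd (hs h2).1 (not_le.mpr h)

open Classical in
/-- The set of colors of the vertical lines through the point `((p i).1, s)`. -/
noncomputable def verticalColors (p : ℕ → ℝ × ℝ)
    (ξ : ℕ × ℕ → Finset ℤ → Finset ℤ → Finset ℤ × Finset ℤ) (i : ℕ) (s : ℝ) : Finset ℤ :=
  if (p i).2 < s then (lines p ξ i (lastBelow p i s)).1 else ∅

/-- `X_{m,n}`: the sum, over the points `z` at which the segment `[m, n] × {n}` meets vertical
lines, of the number modulo `2` of vertical lines through `z` with colors in `{-n, …, -m-1}`. -/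
noncomputable def X (p : ℕ → ℝ × ℝ)
    (ξ : ℕ × ℕ → Finset ℤ → Finset ℤ → Finset ℤ × Finset ℤ) (m n : ℕ) : ℝ :=
  ∑ᶠ i ∈ {i : ℕ | (m : ℝ) ≤ (p i).1 ∧ (p i).1 ≤ n},
    ((((verticalColors p ξ i n).filter fun c => -(n : ℤ) ≤ c ∧ c ≤ -(m : ℤ) - 1).card % 2 : ℕ) : ℝ)

/-! ### The random model -/

/-- The random points `p 0, p 1, …` form a Poisson point process with intensity measure `ν`: the
number of points in a set `A` of finite intensity is Poisson distributed with mean `ν A`, and the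
numbers of points in pairwise disjoint sets are independent. -/
structure IsPoissonProcess {Ω E : Type*} [MeasurableSpace Ω] [MeasurableSpace E] (P : Measure Ω)
    (ν : Measure E) (p : ℕ → Ω → E) : Prop where
  measurable : ∀ i, Measurable (p i)
  hasLaw : ∀ A, MeasurableSet A → ν A ≠ ⊤ →
    HasLaw (fun ω => {i | p i ω ∈ A}.encard)
      ((poissonMeasure (ν A).toNNReal).map (Nat.cast : ℕ → ℕ∞)) P
  indep : ∀ (n : ℕ) (A : Fin n → Set E), (∀ q, MeasurableSet (A q)) →
    Pairwise (Function.onFun Disjoint A) →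
    iIndepFun (fun q ω => {i | p i ω ∈ A q}.encard) P

/-- The random data of the step colored `t`-PNG model: the nucleations `p 0, p 1, …` form a Poisson
point process of density `1` on the open quadrant, and, independently of the nucleations and
independently of each other, the vertices produce outcomes `ξ v`: given input lines `a` from the
bottom and `b` from the left, the output is `(k, l)` with probability `L(a, b; k, l)`, computed with
the colors that are present in the input. -/
structure IsStepColored {Ω : Type*} [MeasurableSpace Ω] (P : Measure Ω) (t : ℝ)
    (p : ℕ → Ω → ℝ × ℝ)
    (ξ : ℕ × ℕ → Ω → Finset ℤ → Finset ℤ → Finset ℤ × Finset ℤ) : Prop where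
  poisson : IsPoissonProcess P (volume.restrict (Set.Ioi (0 : ℝ) ×ˢ Set.Ioi (0 : ℝ))) p
  measurable : ∀ v, Measurable (ξ v)
  law : ∀ (v : ℕ × ℕ) (a b k l : Finset ℤ), k ⊆ a ∪ b → l ⊆ a ∪ b →
    P {ω | ξ v ω a b = (k, l)} = ENNReal.ofReal (L t (a ∪ b) a b k l)
  indep : iIndepFun ξ P
  indep_nucleations : IndepFun (fun ω i => p i ω) (fun ω v => ξ v ω) P

/-- The random variable `X_{m,n}` of the step colored model. -/
noncomputable def randX {Ω : Type*} (p : ℕ → Ω → ℝ × ℝ)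
    (ξ : ℕ × ℕ → Ω → Finset ℤ → Finset ℤ → Finset ℤ × Finset ℤ) (m n : ℕ) (ω : Ω) : ℝ :=
  X (fun i => p i ω) (fun v => ξ v ω) m n

/-- A real-valued process `Y 0, Y 1, …` is ergodic if its law on sequence space is invariant and
ergodic under the shift. -/
def IsErgodicProcess {Ω : Type*} [MeasurableSpace Ω] (P : Measure Ω) (Y : ℕ → Ω → ℝ) : Prop :=
  (∀ n, AEMeasurable (Y n) P) ∧
    Ergodic (fun (y : ℕ → ℝ) n => y (n + 1)) (P.map fun ω n => Y n ω)

end TPNG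

/-!
The nucleations are put on a grid of mesh `1 / D`. When every row and every column of the grid holds
at most one nucleation of `[0, N)²`, the lines of the model are those of a grid model, in which each
cell is a nucleation, a vertex, or passed by at most one bundle of lines (`Separated.realV_eq_colV`,
`Separated.X_eq_gridX`). This fails with a probability of order `N ^ 3 / D`
(`measure_not_separated_le`), so that `X_{m,n}` is read off from a random grid almost surely, and
the law of the `X_{m,n}` is a limit of the laws for the grid models as `D → ∞`.

The two outcomes of a vertex that have positive weight are governed by a coin: either the two
bundles cross, or the projections of the bundles annihilate at every level at which both are `1`
(`outcome`, `proj_annihilated`, `ae_exists_outcome`).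

*Superadditivity.* Write `u` for the projection at level `-1` and `v` for the one at level `-m - 1`.
At every vertex and every nucleation, the lines seen by `u` are created and annihilated in pairs,
and `v (1 - u)` on the vertical lines plus `u (1 - v)` on the horizontal lines does not increase.
Summing the first fact over `[0, m] × [m, n]` and the second over `[m, n]²` bounds the gain of
`X_{0,m}` from below and the loss of `X_{m,n}` from above by the flux of lines through the segment
`{m} × [m, n]` (`gridX_add_le`).

*Laws.* Every vertex is queried with a single pair of inputs, so the outcomes of the vertices may be
replaced by independent coins, one for each cell (`measure_colV_eq`). In the resulting grid model
all colors are governed by the same coins, and the projection at level `-m - 1` on the quadrant with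
corner `(m, m)` is the model with a single color, driven by the nucleations and the coins of that
quadrant alone (`proj_col_eq_single`). As these are independent and identically distributed, the law
of `(X_{m,m+k})_k` does not depend on `m` (`sampleMeasure_topEvent`), and the variables
`X_{nk,(n+1)k}`, which depend on disjoint sets of cells, are independent (`sampleMeasure_blocks`).
Both facts pass to the limit `D → ∞` (`IsStepColored.tendsto_sampleMeasure`). A sequence of
independent and identically distributed random variables is ergodic by Kolmogorov's zero-one law
(`ergodic_shift`). The variables are nonnegative, so that the negative part vanishes.
-/

namespace TPNG

/-! ### Color sets and their projections -/

theorem proj_lt_two (r : ℤ) (a : Finset ℤ) : proj r a < 2 := Nat.mod_lt _ two_pos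

theorem proj_eq_zero_or_one (r : ℤ) (a : Finset ℤ) : proj r a = 0 ∨ proj r a = 1 := by
  have := proj_lt_two r a
  omega

theorem proj_eq_step (r : ℤ) (a : Finset ℤ) :
    proj r a = (proj (r - 1) a + if r ∈ a then 1 else 0) % 2 := by
  have hs : a.filter (· ≤ r) = a.filter (· ≤ r - 1) ∪ a.filter (· = r) := by
    ext c
    simp only [Finset.mem_filter, Finset.mem_union]
    constructor
    · rintro ⟨h, h'⟩
      rcases h'.lt_or_eq with h' | h'
      · exact Or.inl ⟨h, by omega⟩
      · exact Or.inr ⟨h, h'⟩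
    · rintro (⟨h, h'⟩ | ⟨h, h'⟩) <;> exact ⟨h, by omega⟩
  have hd : Disjoint (a.filter (· ≤ r - 1)) (a.filter (· = r)) := by
    rw [Finset.disjoint_filter]
    intro c _ h h'
    omega
  have hc : (a.filter (· = r)).card = if r ∈ a then 1 else 0 := by
    rw [Finset.filter_eq']
    split_ifs <;> simp
  unfold proj
  rw [hs, Finset.card_union_of_disjoint hd, hc]
  omega

theorem proj_ne_proj_sub_one_iff (r : ℤ) (a : Finset ℤ) :
    proj r a ≠ proj (r - 1) a ↔ r ∈ a := by
  have h1 := proj_eq_step r a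
  have h2 := proj_lt_two (r - 1) a
  split_ifs at h1 with h <;> simp only [h, iff_true, iff_false, not_not] <;> omega

theorem proj_eq_zero_of_forall_lt {r : ℤ} {a : Finset ℤ} (h : ∀ c ∈ a, r < c) : proj r a = 0 := by
  unfold proj
  rw [Finset.filter_false_of_mem fun c hc => not_le.mpr (h c hc)]
  rfl

@[simp] theorem proj_empty (r : ℤ) : proj r ∅ = 0 := proj_eq_zero_of_forall_lt (by simp)

theorem proj_singleton (r c : ℤ) : proj r {c} = if c ≤ r then 1 else 0 := by
  unfold proj
  rw [Finset.filter_singleton]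
  split_ifs <;> simp

theorem exists_forall_lt (a : Finset ℤ) : ∃ r : ℤ, ∀ c ∈ a, r < c := by
  obtain ⟨b, hb⟩ := a.bddBelow
  exact ⟨b - 1, fun c hc => by have := hb hc; omega⟩

theorem eq_of_forall_proj_eq {a b : Finset ℤ} (h : ∀ r, proj r a = proj r b) : a = b := by
  ext c
  rw [← proj_ne_proj_sub_one_iff, ← proj_ne_proj_sub_one_iff, h, h]

/-- The colors that continue in the direction of `x` when the line bundles `x` and `y` meet and,
at every level `r` at which both projections are `1`, the two projected lines annihilate. -/
def annihilated (x y : Finset ℤ) : Finset ℤ :=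
  (x ∪ y).filter fun c => proj c x * (1 - proj c y) ≠ proj (c - 1) x * (1 - proj (c - 1) y)

/-- A set of colors is determined by its projections; `annihilated x y` is the one whose
projections are those of `x`, switched off where the projection of `y` is `1`. -/
theorem proj_annihilated (x y : Finset ℤ) (r : ℤ) :
    proj r (annihilated x y) = proj r x * (1 - proj r y) := by
  obtain ⟨r₀, h₀⟩ := exists_forall_lt (x ∪ y)
  have low : ∀ s ≤ r₀, proj s (annihilated x y) = proj s x * (1 - proj s y) := by
    intro s hs
    rw [proj_eq_zero_of_forall_lt (a := annihilated x y)
        fun c hc => hs.trans_lt (h₀ c (Finset.mem_filter.mp hc).1),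
      proj_eq_zero_of_forall_lt fun c hc => hs.trans_lt (h₀ c (Finset.mem_union_left y hc)),
      zero_mul]
  rcases le_total r r₀ with h | h
  · exact low r h
  · induction r, h using Int.leInduction with
    | base => exact low _ le_rfl
    | succ s _ ih =>
      have h1 := proj_ne_proj_sub_one_iff (s + 1) (annihilated x y)
      have hx := proj_ne_proj_sub_one_iff (s + 1) x
      have hy := proj_ne_proj_sub_one_iff (s + 1) y
      have hm : s + 1 ∈ annihilated x y ↔ (s + 1 ∈ x ∨ s + 1 ∈ y) ∧
          proj (s + 1) x * (1 - proj (s + 1) y) ≠ proj s x * (1 - proj s y) := by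
        rw [annihilated, Finset.mem_filter, Finset.mem_union, add_sub_cancel_right]
      rw [add_sub_cancel_right] at h1 hx hy
      rw [hm, ih, ← hx, ← hy] at h1
      rcases proj_eq_zero_or_one (s + 1) (annihilated x y) with h2 | h2 <;>
      rcases proj_eq_zero_or_one (s + 1) x with h3 | h3 <;>
      rcases proj_eq_zero_or_one (s + 1) y with h4 | h4 <;>
      rcases proj_eq_zero_or_one s x with h5 | h5 <;>
      rcases proj_eq_zero_or_one s y with h6 | h6 <;>
      simp_all

theorem annihilated_subset (x y : Finset ℤ) : annihilated x y ⊆ x ∪ y := Finset.filter_subset _ _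

theorem annihilated_eq_left {x y : Finset ℤ} (h : ∀ r, proj r x = 1 → proj r y ≠ 1) :
    annihilated x y = x := by
  refine eq_of_forall_proj_eq fun r => ?_
  rw [proj_annihilated]
  rcases proj_eq_zero_or_one r x with h1 | h1
  · simp [h1]
  · rcases proj_eq_zero_or_one r y with h2 | h2
    · simp [h2]
    · exact absurd h2 (h r h1)

@[simp] theorem annihilated_empty_right (x : Finset ℤ) : annihilated x ∅ = x :=
  annihilated_eq_left (by simp)

@[simp] theorem annihilated_empty_left (x : Finset ℤ) : annihilated ∅ x = ∅ :=
  annihilated_eq_left (by simp)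

/-- The outcome of a vertex with inputs `x` from the bottom and `y` from the left, as decided by a
coin: either the bundles cross, or they annihilate at every level at which they meet. -/
def outcome (coin : Bool) (x y : Finset ℤ) : Finset ℤ × Finset ℤ :=
  if coin then (x, y) else (annihilated x y, annihilated y x)

/-! ### The vertex weights form a stochastic matrix -/

/-- The projections are constant between consecutive colors that are present, so that two bundles
which meet at some level meet at the level of one of their colors. -/
theorem exists_mem_proj_eq_one {x y : Finset ℤ} {r : ℤ} (hx : proj r x = 1) (hy : proj r y = 1) :
    ∃ s ∈ x ∪ y, proj s x = 1 ∧ proj s y = 1 := by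
  obtain ⟨r₀, h₀⟩ := exists_forall_lt (x ∪ y)
  have low : ∀ s ≤ r₀, proj s x = 0 := fun s hs =>
    proj_eq_zero_of_forall_lt fun c hc => hs.trans_lt (h₀ c (Finset.mem_union_left y hc))
  rcases le_total r r₀ with h | h
  · exact absurd (low r h) (by omega)
  · induction r, h using Int.leInduction with
    | base => exact absurd (low _ le_rfl) (by omega)
    | succ s _ ih =>
      by_cases hs : s + 1 ∈ x ∪ y
      · exact ⟨_, hs, hx, hy⟩
      · rw [Finset.mem_union, not_or] at hs
        have h1 := proj_eq_step (s + 1) x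
        have h2 := proj_eq_step (s + 1) y
        have := proj_lt_two s x
        have := proj_lt_two s y
        rw [if_neg hs.1, add_sub_cancel_right] at h1
        rw [if_neg hs.2, add_sub_cancel_right] at h2
        exact ih (by omega) (by omega)

theorem L1_pass {i j : ℕ} (hi : i = 0 ∨ i = 1) (hj : j = 0 ∨ j = 1) :
    L1 i j i j = if i = 1 ∧ j = 1 then .tt else .one := by
  rcases hi with rfl | rfl <;> rcases hj with rfl | rfl <;> rfl

theorem L1_annihilate {i j : ℕ} (hi : i = 0 ∨ i = 1) (hj : j = 0 ∨ j = 1) :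
    L1 i j (i * (1 - j)) (j * (1 - i)) = if i = 1 ∧ j = 1 then .oneSubT else .one := by
  rcases hi with rfl | rfl <;> rcases hj with rfl | rfl <;> rfl

theorem modMin_image {S : Finset ℤ} {q : ℤ → Prop} [DecidablePred q] {w : Weight}
    (hw : w = .tt ∨ w = .oneSubT) (hS : ∃ r ∈ S, q r) :
    modMin (S.image fun r => if q r then w else .one) = w := by
  obtain ⟨r, hr, hq⟩ := hS
  have hmem : w ∈ S.image fun r => if q r then w else .one :=
    Finset.mem_image.mpr ⟨r, hr, if_pos hq⟩
  have hsub : ∀ v ∈ S.image fun r => if q r then w else .one, v = w ∨ v = .one := by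
    intro v hv
    obtain ⟨s, -, rfl⟩ := Finset.mem_image.mp hv
    split_ifs <;> simp
  generalize (S.image fun r => if q r then w else .one) = W at *
  have h0 : Weight.zero ∉ W := fun h => by
    rcases hw with rfl | rfl <;> simpa using hsub _ h
  rcases hw with rfl | rfl
  · have h1 : Weight.oneSubT ∉ W := fun h => by simpa using hsub _ h
    simp [modMin, h0, h1, hmem]
  · have h1 : Weight.tt ∉ W := fun h => by simpa using hsub _ h
    simp [modMin, h0, h1, hmem]

theorem L_pass (t : ℝ) {x y : Finset ℤ} {r : ℤ} (hx : proj r x = 1) (hy : proj r y = 1) :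
    L t (x ∪ y) x y x y = t := by
  unfold L
  simp_rw [L1_pass (proj_eq_zero_or_one _ x) (proj_eq_zero_or_one _ y)]
  rw [modMin_image (Or.inl rfl) (exists_mem_proj_eq_one hx hy)]
  rfl

theorem L_annihilate (t : ℝ) {x y : Finset ℤ} {r : ℤ} (hx : proj r x = 1) (hy : proj r y = 1) :
    L t (x ∪ y) x y (annihilated x y) (annihilated y x) = 1 - t := by
  unfold L
  simp_rw [proj_annihilated, L1_annihilate (proj_eq_zero_or_one _ x) (proj_eq_zero_or_one _ y)]
  rw [modMin_image (Or.inr rfl) (exists_mem_proj_eq_one hx hy)]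
  rfl

theorem L_pass_of_forall (t : ℝ) {x y : Finset ℤ} (h : ∀ r, proj r x = 1 → proj r y ≠ 1) :
    L t (x ∪ y) x y x y = 1 := by
  unfold L
  simp_rw [L1_pass (proj_eq_zero_or_one _ x) (proj_eq_zero_or_one _ y)]
  have hW : ∀ v ∈ (x ∪ y).image fun r =>
      if proj r x = 1 ∧ proj r y = 1 then Weight.tt else Weight.one, v = .one := by
    intro v hv
    obtain ⟨s, -, rfl⟩ := Finset.mem_image.mp hv
    exact if_neg fun hs => h s hs.1 hs.2
  generalize ((x ∪ y).image fun r =>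
      if proj r x = 1 ∧ proj r y = 1 then Weight.tt else Weight.one) = W at *
  have h0 : Weight.zero ∉ W := fun h => by simpa using hW _ h
  have h1 : Weight.tt ∉ W := fun h => by simpa using hW _ h
  have h2 : Weight.oneSubT ∉ W := fun h => by simpa using hW _ h
  simp [modMin, h0, h1, h2, Weight.val]

theorem annihilated_ne_left {x y : Finset ℤ} {r : ℤ} (hx : proj r x = 1) (hy : proj r y = 1) :
    annihilated x y ≠ x := by
  intro h
  have := proj_annihilated x y r
  rw [h, hx, hy] at this
  omega

/-! ### Line configurations on a grid -/

section Grid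

variable {α : Type*}

/-- The states entering the cells of one row from the left, where `z` enters the first cell, `v a`
enters the cell `a` from the bottom, and `φ a x y` is the pair of the states that leave the cell `a`
through its top and its right side when `x` and `y` enter it from the bottom and from the left. -/
def gridRow (z : α) (φ : ℕ → α → α → α × α) (v : ℕ → α) : ℕ → α
  | 0 => z
  | a + 1 => (φ a (v a) (gridRow z φ v a)).2

/-- `gridV z Φ b a` is the state that enters the cell in row `b` and column `a` from the bottom,
when `z` enters the quadrant everywhere on its boundary and `Φ b a` is the local rule of this cell.
-/
def gridV (z : α) (Φ : ℕ → ℕ → α → α → α × α) : ℕ → ℕ → α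
  | 0 => fun _ => z
  | b + 1 => fun a => (Φ b a (gridV z Φ b a) (gridRow z (Φ b) (gridV z Φ b) a)).1

/-- `gridH z Φ b a` is the state that enters the cell in row `b` and column `a` from the left. -/
def gridH (z : α) (Φ : ℕ → ℕ → α → α → α × α) (b : ℕ) : ℕ → α :=
  gridRow z (Φ b) (gridV z Φ b)

variable {z : α} {Φ Ψ : ℕ → ℕ → α → α → α × α}

@[simp] theorem gridV_zero (a : ℕ) : gridV z Φ 0 a = z := rfl

@[simp] theorem gridH_zero (b : ℕ) : gridH z Φ b 0 = z := rfl

theorem gridV_succ (b a : ℕ) :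
    gridV z Φ (b + 1) a = (Φ b a (gridV z Φ b a) (gridH z Φ b a)).1 := rfl

theorem gridH_succ (b a : ℕ) :
    gridH z Φ b (a + 1) = (Φ b a (gridV z Φ b a) (gridH z Φ b a)).2 := rfl

/-- The states are the only ones that obey the local rules; this is needed only within a square. -/
theorem grid_unique {K : ℕ} {V H : ℕ → ℕ → α} (hV0 : ∀ a < K, V 0 a = z) (hH0 : ∀ b < K, H b 0 = z)
    (h : ∀ b < K, ∀ a < K, (V (b + 1) a, H b (a + 1)) = Φ b a (V b a) (H b a)) :
    (∀ b ≤ K, ∀ a < K, V b a = gridV z Φ b a) ∧ ∀ b < K, ∀ a ≤ K, H b a = gridH z Φ b a := by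
  have row : ∀ b < K, (∀ a < K, V b a = gridV z Φ b a) → ∀ a ≤ K, H b a = gridH z Φ b a := by
    intro b hb hv a
    induction a with
    | zero => exact fun _ => hH0 b hb
    | succ a ih =>
      intro ha
      rw [gridH_succ, ← ih (by omega), ← hv a (by omega), ← h b hb a (by omega)]
  have col : ∀ b ≤ K, ∀ a < K, V b a = gridV z Φ b a := by
    intro b
    induction b with
    | zero => exact fun _ a ha => hV0 a ha
    | succ b ih =>
      intro hb a ha
      rw [gridV_succ, ← ih (by omega) a ha, ← row b (by omega) (ih (by omega)) a ha.le,
        ← h b (by omega) a ha]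
  exact ⟨col, fun b hb => row b hb (col b hb.le)⟩

/-- A property of states that holds on the boundary and is preserved by the local rules. -/
theorem grid_induction {p q : ℕ → ℕ → α → Prop} (hp : ∀ a, p 0 a z) (hq : ∀ b, q b 0 z)
    (h : ∀ b a, p b a (gridV z Φ b a) → q b a (gridH z Φ b a) →
      p (b + 1) a (gridV z Φ (b + 1) a) ∧ q b (a + 1) (gridH z Φ b (a + 1))) :
    ∀ b a, p b a (gridV z Φ b a) ∧ q b a (gridH z Φ b a) := by
  have row : ∀ b, (∀ a, p b a (gridV z Φ b a)) → ∀ a, q b a (gridH z Φ b a) := by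
    intro b hv a
    induction a with
    | zero => exact hq b
    | succ a ih => exact (h b a (hv a) ih).2
  have col : ∀ b, ∀ a, p b a (gridV z Φ b a) := by
    intro b
    induction b with
    | zero => exact hp
    | succ b ih => exact fun a => (h b a (ih a) (row b ih a)).1
  exact fun b a => ⟨col b a, row b (col b) a⟩

end Grid

/-- Summing a local inequality between what leaves and what enters each cell over a rectangle. -/
theorem sum_rectangle_le {F G : ℕ → ℕ → ℤ} {a₀ a₁ b₀ b₁ : ℕ} (ha : a₀ ≤ a₁) (hb : b₀ ≤ b₁)
    (h : ∀ b a, b₀ ≤ b → b < b₁ → a₀ ≤ a → a < a₁ → F (b + 1) a + G b (a + 1) ≤ F b a + G b a) :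
    ∑ a ∈ Finset.Ico a₀ a₁, F b₁ a + ∑ b ∈ Finset.Ico b₀ b₁, G b a₁ ≤
      ∑ a ∈ Finset.Ico a₀ a₁, F b₀ a + ∑ b ∈ Finset.Ico b₀ b₁, G b a₀ := by
  have row : ∀ b, b₀ ≤ b → b < b₁ → ∑ a ∈ Finset.Ico a₀ a₁, F (b + 1) a + G b a₁ ≤
      ∑ a ∈ Finset.Ico a₀ a₁, F b a + G b a₀ := by
    intro b hb0 hb1
    have hs := Finset.sum_le_sum fun a (hm : a ∈ Finset.Ico a₀ a₁) =>
      h b a hb0 hb1 (Finset.mem_Ico.mp hm).1 (Finset.mem_Ico.mp hm).2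
    rw [Finset.sum_add_distrib, Finset.sum_add_distrib] at hs
    have ht := Finset.sum_Ico_sub (fun a => G b a) ha
    rw [Finset.sum_sub_distrib] at ht
    linarith
  have hs := Finset.sum_le_sum fun b (hm : b ∈ Finset.Ico b₀ b₁) =>
    row b (Finset.mem_Ico.mp hm).1 (Finset.mem_Ico.mp hm).2
  rw [Finset.sum_add_distrib, Finset.sum_add_distrib] at hs
  have ht := Finset.sum_Ico_sub (fun b => ∑ a ∈ Finset.Ico a₀ a₁, F b a) hb
  rw [Finset.sum_sub_distrib] at ht
  linarith

/-! ### The colored model on a grid -/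

/-- The color of the nucleations in the cell in row `b` and column `a` of the grid of mesh
`1 / D`. -/
def cellColor (D b a : ℕ) : ℤ := -(min (b / D) (a / D) + 1 : ℕ)

/-- There are nucleations both in the column below and in the row to the left of the given cell. -/
def Meets (c : ℕ → ℕ → Bool) (b a : ℕ) : Prop :=
  (∃ b' < b, c b' a = true) ∧ ∃ a' < a, c b a' = true

open Classical in
/-- The local rule of the colored model on the grid of mesh `1 / D`, where `c` marks the cells that
contain nucleations, and `o b a` gives the outcomes of the vertex in row `b` and column `a`. -/
noncomputable def cellRule (D : ℕ) (c : ℕ → ℕ → Bool)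
    (o : ℕ → ℕ → Finset ℤ → Finset ℤ → Finset ℤ × Finset ℤ) (b a : ℕ) (x y : Finset ℤ) :
    Finset ℤ × Finset ℤ :=
  if c b a = true then ({cellColor D b a}, {cellColor D b a})
  else if Meets c b a then o b a x y else (x, y)

/-- The colors entering the cell in row `b` and column `a` from the bottom. -/
noncomputable def colV (D : ℕ) (c : ℕ → ℕ → Bool)
    (o : ℕ → ℕ → Finset ℤ → Finset ℤ → Finset ℤ × Finset ℤ) : ℕ → ℕ → Finset ℤ :=
  gridV ∅ (cellRule D c o)

/-- The colors entering the cell in row `b` and column `a` from the left. -/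
noncomputable def colH (D : ℕ) (c : ℕ → ℕ → Bool)
    (o : ℕ → ℕ → Finset ℤ → Finset ℤ → Finset ℤ × Finset ℤ) : ℕ → ℕ → Finset ℤ :=
  gridH ∅ (cellRule D c o)

/-- The local rule of the model with a single color. -/
def singleRule (nucleation coin : Bool) (x y : ℕ) : ℕ × ℕ :=
  if nucleation then (1, 1) else if coin then (x, y) else (x * (1 - y), y * (1 - x))

section Colored

variable {D : ℕ} {c : ℕ → ℕ → Bool} {o : ℕ → ℕ → Finset ℤ → Finset ℤ → Finset ℤ × Finset ℤ}

theorem colV_eq_empty_and_colH_eq_empty (b a : ℕ) :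
    ((∀ b' < b, c b' a = false) → colV D c o b a = ∅) ∧
      ((∀ a' < a, c b a' = false) → colH D c o b a = ∅) := by
  refine grid_induction (p := fun b a x => (∀ b' < b, c b' a = false) → x = ∅)
    (q := fun b a y => (∀ a' < a, c b a' = false) → y = ∅) (by simp) (by simp) ?_ b a
  intro b a hp hq
  rw [gridV_succ, gridH_succ]
  constructor
  · intro h
    have hm : ¬ Meets c b a := fun hm => by
      obtain ⟨b', hb', h'⟩ := hm.1
      simp [h b' (by omega)] at h'
    simp [cellRule, h b (by omega), hm, hp fun b' hb' => h b' (by omega)]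
  · intro h
    have hm : ¬ Meets c b a := fun hm => by
      obtain ⟨a', ha', h'⟩ := hm.2
      simp [h a' (by omega)] at h'
    simp [cellRule, h a (by omega), hm, hq fun a' ha' => h a' (by omega)]

/-- Away from the nucleations the coins decide. If there is no vertex then one of the inputs is
empty, and both sides of the coin give the same. -/
theorem cellRule_eq_outcome {b a : ℕ} {coin : Bool}
    (ho : o b a (colV D c o b a) (colH D c o b a) =
      outcome coin (colV D c o b a) (colH D c o b a)) (hc : c b a = false) :
    colV D c o (b + 1) a = (outcome coin (colV D c o b a) (colH D c o b a)).1 ∧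
      colH D c o b (a + 1) = (outcome coin (colV D c o b a) (colH D c o b a)).2 := by
  rw [← Prod.ext_iff (x := (_, _))]
  have h : (colV D c o (b + 1) a, colH D c o b (a + 1)) =
    cellRule D c o b a (colV D c o b a) (colH D c o b a) := rfl
  rw [h, cellRule, if_neg (by simp [hc])]
  split_ifs with hm
  · exact ho
  · obtain ⟨h1, h2⟩ := colV_eq_empty_and_colH_eq_empty (D := D) (c := c) (o := o) b a
    by_cases hv : ∃ b' < b, c b' a = true
    · have hh : colH D c o b a = ∅ := h2 fun a' ha' => by
        by_contra h
        exact hm ⟨hv, a', ha', by simpa using h⟩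
      cases coin <;> simp [outcome, hh]
    · have hh : colV D c o b a = ∅ := h1 fun b' hb' => by
        by_contra h
        exact hv ⟨b', hb', by simpa using h⟩
      cases coin <;> simp [outcome, hh]

theorem col_eq_of_nucleation {b a : ℕ} (hc : c b a = true) :
    colV D c o (b + 1) a = {cellColor D b a} ∧ colH D c o b (a + 1) = {cellColor D b a} := by
  have h : (colV D c o (b + 1) a, colH D c o b (a + 1)) =
    cellRule D c o b a (colV D c o b a) (colH D c o b a) := rfl
  rw [cellRule, if_pos hc] at h
  exact Prod.ext_iff.mp h

theorem outcome_subset {coin : Bool} {x y : Finset ℤ} :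
    (outcome coin x y).1 ⊆ x ∪ y ∧ (outcome coin x y).2 ⊆ x ∪ y := by
  cases coin
  · exact ⟨annihilated_subset x y, (annihilated_subset y x).trans (Finset.union_comm y x).subset⟩
  · exact ⟨Finset.subset_union_left, Finset.subset_union_right⟩

/-- Colors come from nucleations in the rectangle to the lower left. -/
theorem exists_cellColor (ho : ∀ b a x y, ∃ coin, o b a x y = outcome coin x y) (b a : ℕ) :
    (∀ s ∈ colV D c o b a, ∃ b' < b, ∃ a' ≤ a, s = cellColor D b' a') ∧
      ∀ s ∈ colH D c o b a, ∃ b' ≤ b, ∃ a' < a, s = cellColor D b' a' := by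
  refine grid_induction
    (p := fun b a x => ∀ s ∈ x, ∃ b' < b, ∃ a' ≤ a, s = cellColor D b' a')
    (q := fun b a x => ∀ s ∈ x, ∃ b' ≤ b, ∃ a' < a, s = cellColor D b' a')
    (by simp) (by simp) ?_ b a
  intro b a hp hq
  change (∀ s ∈ colV D c o b a, _) at hp
  change (∀ s ∈ colH D c o b a, _) at hq
  change (∀ s ∈ colV D c o (b + 1) a, _) ∧ (∀ s ∈ colH D c o b (a + 1), _)
  cases hc : c b a
  · obtain ⟨coin, hcoin⟩ := ho b a (colV D c o b a) (colH D c o b a)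
    have h := cellRule_eq_outcome hcoin hc
    have hs : ∀ s ∈ colV D c o b a ∪ colH D c o b a,
        ∃ b' ≤ b, ∃ a' ≤ a, s = cellColor D b' a' := by
      intro s hs
      rcases Finset.mem_union.mp hs with hs | hs
      · obtain ⟨b', hb', a', ha', rfl⟩ := hp s hs
        exact ⟨b', hb'.le, a', ha', rfl⟩
      · obtain ⟨b', hb', a', ha', rfl⟩ := hq s hs
        exact ⟨b', hb', a', ha'.le, rfl⟩
    rw [h.1, h.2]
    refine ⟨fun s h => ?_, fun s h => ?_⟩
    · obtain ⟨b', hb', a', ha', rfl⟩ := hs s (outcome_subset.1 h)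
      exact ⟨b', by omega, a', ha', rfl⟩
    · obtain ⟨b', hb', a', ha', rfl⟩ := hs s (outcome_subset.2 h)
      exact ⟨b', hb', a', by omega, rfl⟩
  · obtain ⟨h1, h2⟩ := col_eq_of_nucleation (D := D) (o := o) hc
    rw [h1, h2]
    simp only [Finset.mem_singleton, forall_eq]
    exact ⟨⟨b, by omega, a, le_rfl, rfl⟩, ⟨b, le_rfl, a, by omega, rfl⟩⟩

theorem neg_le_cellColor {b a m : ℕ} (h : b < m * D ∨ a < m * D) : -(m : ℤ) ≤ cellColor D b a := by
  have : min (b / D) (a / D) + 1 ≤ m := by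
    rcases h with h | h
    · have := Nat.div_lt_of_lt_mul (mul_comm m D ▸ h)
      omega
    · have := Nat.div_lt_of_lt_mul (mul_comm m D ▸ h)
      omega
  unfold cellColor
  omega

theorem cellColor_le {b a m : ℕ} (hD : 0 < D) (hb : m * D ≤ b) (ha : m * D ≤ a) :
    cellColor D b a ≤ -(m : ℤ) - 1 := by
  have h1 := (Nat.le_div_iff_mul_le hD).mpr hb
  have h2 := (Nat.le_div_iff_mul_le hD).mpr ha
  unfold cellColor
  omega

theorem cellColor_le_neg_one (b a : ℕ) : cellColor D b a ≤ -1 := by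
  unfold cellColor
  generalize min (b / D) (a / D) = q
  omega

/-- Lines of high priority stay in the quadrant with corner `(m, m)`. -/
theorem proj_colV_eq_zero (ho : ∀ b a x y, ∃ coin, o b a x y = outcome coin x y) {b a m : ℕ}
    (hb : b ≤ m * D) : proj (-(m : ℤ) - 1) (colV D c o b a) = 0 := by
  refine proj_eq_zero_of_forall_lt fun s hs => ?_
  obtain ⟨b', hb', a', -, rfl⟩ := (exists_cellColor ho b a).1 s hs
  have := neg_le_cellColor (a := a') (Or.inl (hb'.trans_le hb))
  omega

theorem proj_colH_eq_zero (ho : ∀ b a x y, ∃ coin, o b a x y = outcome coin x y) {b a m : ℕ}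
    (ha : a ≤ m * D) : proj (-(m : ℤ) - 1) (colH D c o b a) = 0 := by
  refine proj_eq_zero_of_forall_lt fun s hs => ?_
  obtain ⟨b', -, a', ha', rfl⟩ := (exists_cellColor ho b a).2 s hs
  have := neg_le_cellColor (b := b') (Or.inr (ha'.trans_le ha))
  omega

/-- The lines of high priority, counted modulo `2`, form a model with a single color on the quadrant
with corner `(m, m)`: the projections of an outcome depend only on the projections of the inputs and
on the coin. -/
theorem proj_col_eq_single (hD : 0 < D) (coin : ℕ → ℕ → Bool) (m b a : ℕ) :
    let o := fun b a => outcome (coin b a)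
    let Φ := fun b a => singleRule (c (m * D + b) (m * D + a)) (coin (m * D + b) (m * D + a))
    proj (-(m : ℤ) - 1) (colV D c o (m * D + b) (m * D + a)) = gridV 0 Φ b a ∧
      proj (-(m : ℤ) - 1) (colH D c o (m * D + b) (m * D + a)) = gridH 0 Φ b a := by
  intro o Φ
  have ho : ∀ b a x y, ∃ coin, o b a x y = outcome coin x y := fun b a x y => ⟨coin b a, rfl⟩
  refine grid_induction
    (p := fun b a x => proj (-(m : ℤ) - 1) (colV D c o (m * D + b) (m * D + a)) = x)
    (q := fun b a x => proj (-(m : ℤ) - 1) (colH D c o (m * D + b) (m * D + a)) = x)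
    (fun a => proj_colV_eq_zero ho (by omega)) (fun b => proj_colH_eq_zero ho (by omega)) ?_ b a
  intro b a hp hq
  rw [gridV_succ, gridH_succ, ← hp, ← hq]
  cases hc : c (m * D + b) (m * D + a)
  · have h := cellRule_eq_outcome (o := o) (D := D) rfl hc
    rw [← add_assoc, ← add_assoc, h.1, h.2]
    cases hcoin : coin (m * D + b) (m * D + a) <;>
    simp [Φ, singleRule, hc, hcoin, outcome, proj_annihilated]
  · have h := col_eq_of_nucleation (D := D) (o := o) hc
    rw [← add_assoc, ← add_assoc, h.1, h.2, proj_singleton,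
      if_pos (cellColor_le hD (by omega) (by omega))]
    simp [Φ, singleRule, hc]

/-! ### Superadditivity -/

/-- The number of lines at the top side of the square `[m, n]²`, for lines with colors of label at
most `-m - 1`, counted modulo `2` in each column. -/
noncomputable def gridX (D : ℕ) (V : ℕ → ℕ → Finset ℤ) (m n : ℕ) : ℕ :=
  ∑ a ∈ Finset.Ico (m * D) (n * D), proj (-(m : ℤ) - 1) (V (n * D) a)

/-- A vertical line that is seen by the projection at level `-m - 1` but not at level `-1`, or a
horizontal line that is seen at level `-1` but not at level `-m - 1`, can be traced back through the
vertices: their number does not increase. -/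
theorem defect_outcome_le (coin : Bool) (x y : Finset ℤ) (r s : ℤ) :
    (proj r (outcome coin x y).1 * (1 - proj s (outcome coin x y).1) : ℤ) +
        proj s (outcome coin x y).2 * (1 - proj r (outcome coin x y).2) ≤
      proj r x * (1 - proj s x) + proj s y * (1 - proj r y) := by
  cases coin
  · simp only [outcome, Bool.false_eq_true, if_false, proj_annihilated]
    rcases proj_eq_zero_or_one r x with h1 | h1 <;> rcases proj_eq_zero_or_one r y with h2 | h2 <;>
    rcases proj_eq_zero_or_one s x with h3 | h3 <;> rcases proj_eq_zero_or_one s y with h4 | h4 <;>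
    simp [h1, h2, h3, h4]
  · simp [outcome]

/-- At a vertex, the numbers of lines at the left and at the top add up to the same as those at the
bottom and at the right. -/
theorem flux_outcome (coin : Bool) (x y : Finset ℤ) (r : ℤ) :
    (proj r (outcome coin x y).1 + proj r y : ℤ) = proj r x + proj r (outcome coin x y).2 := by
  cases coin
  · simp only [outcome, Bool.false_eq_true, if_false, proj_annihilated]
    rcases proj_eq_zero_or_one r x with h1 | h1 <;> rcases proj_eq_zero_or_one r y with h2 | h2 <;>
    simp [h1, h2]
  · simp [outcome]

/-- The lines met by the top side of `[0, m] × [m, n]` exceed those met by the bottom side by at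
least the number of lines that leave through the right side. The lines of high priority on the top
side of `[m, n]²` exceed those of the full model by at most the same number, since every line of
high priority that is invisible in the full model is owed to a line entering from the left. -/
theorem gridX_add_le (hD : 0 < D) (ho : ∀ b a x y, ∃ coin, o b a x y = outcome coin x y)
    {m n : ℕ} (hmn : m ≤ n) (hc : ∀ b < n * D, ∀ a < n * D, c b a = true →
      (∀ b' < b, c b' a = false) ∧ ∀ a' < a, c b a' = false) :
    gridX D (colV D c o) 0 m + gridX D (colV D c o) m n ≤ gridX D (colV D c o) 0 n := by
  set V := colV D c o with hV
  set H := colH D c o with hH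
  have hm : m * D ≤ n * D := Nat.mul_le_mul_right D hmn
  have left := sum_rectangle_le (F := fun b a => -(proj (-1) (V b a) : ℤ))
    (G := fun b a => (proj (-1) (H b a) : ℤ)) (Nat.zero_le (m * D)) hm fun b a _ hb _ ha => by
      cases hba : c b a
      · obtain ⟨coin, hcoin⟩ := ho b a (V b a) (H b a)
        have h := cellRule_eq_outcome hcoin hba
        have := flux_outcome coin (V b a) (H b a) (-1)
        rw [← h.1, ← h.2] at this
        linarith
      · obtain ⟨h1, h2⟩ := col_eq_of_nucleation (D := D) (o := o) hba
        obtain ⟨h3, h4⟩ := hc b hb a (ha.trans_le hm) hba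
        simp only [hV, hH]
        rw [h1, h2, (colV_eq_empty_and_colH_eq_empty b a).1 h3,
          (colV_eq_empty_and_colH_eq_empty b a).2 h4]
        simp
  have right := sum_rectangle_le
    (F := fun b a => (proj (-m - 1) (V b a) * (1 - proj (-1) (V b a)) : ℤ))
    (G := fun b a => (proj (-1) (H b a) * (1 - proj (-m - 1) (H b a)) : ℤ))
    hm hm fun b a hb _ ha _ => by
      cases hba : c b a
      · obtain ⟨coin, hcoin⟩ := ho b a (V b a) (H b a)
        have h := cellRule_eq_outcome hcoin hba
        have := defect_outcome_le coin (V b a) (H b a) (-m - 1) (-1)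
        rw [← h.1, ← h.2] at this
        exact this
      · obtain ⟨h1, h2⟩ := col_eq_of_nucleation (D := D) (o := o) hba
        have hx : ∀ r x, (0 : ℤ) ≤ 1 - proj r x := fun r x => by
          have := proj_lt_two r x
          omega
        simp only [hV, hH]
        rw [h1, h2, proj_singleton, proj_singleton, if_pos (cellColor_le hD hb ha),
          if_pos (cellColor_le_neg_one b a)]
        have := mul_nonneg (Int.natCast_nonneg (proj (-m - 1) (colV D c o b a)))
          (hx (-1) (colV D c o b a))
        have := mul_nonneg (Int.natCast_nonneg (proj (-1) (colH D c o b a)))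
          (hx (-m - 1) (colH D c o b a))
        simp only [Nat.cast_one, sub_self, mul_zero, add_zero]
        linarith
  have hV0 : ∀ a, proj (-(m : ℤ) - 1) (V (m * D) a) = 0 := fun a => proj_colV_eq_zero ho le_rfl
  have hH0 : ∀ b, proj (-(m : ℤ) - 1) (H b (m * D)) = 0 := fun b => proj_colH_eq_zero ho le_rfl
  have hL0 : ∀ b, H b 0 = ∅ := fun b => rfl
  simp only [hV0, hH0, hL0, proj_empty, Nat.cast_zero, zero_mul, sub_zero, mul_one,
    Finset.sum_const_zero, zero_add, add_zero, Finset.sum_neg_distrib] at left right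
  have pointwise : ∀ a, (proj (-m - 1) (V (n * D) a) : ℤ) ≤ proj (-1) (V (n * D) a) +
      proj (-m - 1) (V (n * D) a) * (1 - proj (-1) (V (n * D) a)) := by
    intro a
    rcases proj_eq_zero_or_one (-m - 1) (V (n * D) a) with h1 | h1 <;>
    rcases proj_eq_zero_or_one (-1) (V (n * D) a) with h2 | h2 <;> simp [h1, h2]
  have top := Finset.sum_le_sum fun a (_ : a ∈ Finset.Ico (m * D) (n * D)) => pointwise a
  rw [Finset.sum_add_distrib] at top
  have hG : 0 ≤ ∑ b ∈ Finset.Ico (m * D) (n * D),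
      (proj (-1) (H b (n * D)) * (1 - proj (-m - 1) (H b (n * D))) : ℤ) := by
    refine Finset.sum_nonneg fun b _ => mul_nonneg (Int.natCast_nonneg _) ?_
    have := proj_lt_two (-m - 1) (H b (n * D))
    omega
  have split := Finset.sum_Ico_consecutive (fun a => (proj (-1) (V (n * D) a) : ℤ))
    (Nat.zero_le (m * D)) hm
  have key : ((gridX D V 0 m + gridX D V m n : ℕ) : ℤ) ≤ (gridX D V 0 n : ℕ) := by
    simp only [gridX, Nat.cast_add, Nat.cast_sum, Nat.cast_zero, neg_zero, zero_sub, zero_mul]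
    linarith
  exact_mod_cast key

end Colored

/-! ### The lines of a configuration of nucleations -/

section Lines

variable {p : ℕ → ℝ × ℝ} {ξ : ℕ × ℕ → Finset ℤ → Finset ℤ → Finset ℤ × Finset ℤ} {i j : ℕ}
  {s s' : ℝ}

theorem lastBelow_congr (hs : s ≤ s')
    (h : ∀ k, (p k).1 ≤ (p i).1 → (p i).2 ≤ (p k).2 → (p k).2 < s' → (p k).2 < s) :
    lastBelow p i s' = lastBelow p i s := by
  have key : ∀ k, (p k).1 ≤ (p i).1 → (p i).2 ≤ (p k).2 → ((p k).2 < s' ↔ (p k).2 < s) :=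
    fun k h1 h2 => ⟨h k h1 h2, fun h3 => h3.trans_le hs⟩
  unfold lastBelow
  congr 1
  ext j
  constructor
  · rintro ⟨⟨h1, h2, h3⟩, h4⟩
    exact ⟨⟨h1, h2, (key j h1 h2).mp h3⟩, fun k k1 k2 k3 => h4 k k1 k2 ((key k k1 k2).mpr k3)⟩
  · rintro ⟨⟨h1, h2, h3⟩, h4⟩
    exact ⟨⟨h1, h2, (key j h1 h2).mpr h3⟩, fun k k1 k2 k3 => h4 k k1 k2 ((key k k1 k2).mp k3)⟩

theorem lastBelow_eq (hx : (p j).1 ≤ (p i).1) (hy : (p i).2 ≤ (p j).2) (hs : (p j).2 < s)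
    (h : ∀ k, (p k).1 ≤ (p i).1 → (p k).2 < s → k ≠ j → (p k).2 < (p j).2) :
    lastBelow p i s = j := by
  have hset : {j' | ((p j').1 ≤ (p i).1 ∧ (p i).2 ≤ (p j').2 ∧ (p j').2 < s) ∧
      ∀ k, (p k).1 ≤ (p i).1 → (p i).2 ≤ (p k).2 → (p k).2 < s → (p k).2 ≤ (p j').2} = {j} := by
    ext j'
    simp only [Set.mem_ofPred_eq, Set.mem_singleton_iff]
    constructor
    · rintro ⟨⟨h1, -, h3⟩, h4⟩
      by_contra hne
      exact absurd (h j' h1 h3 hne) (not_lt.mpr (h4 j hx hy hs))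
    · rintro rfl
      refine ⟨⟨hx, hy, hs⟩, fun k k1 _ k3 => ?_⟩
      rcases eq_or_ne k j' with rfl | hk
      · exact le_rfl
      · exact (h k k1 k3 hk).le
  unfold lastBelow
  rw [hset, csInf_singleton]

/-- The model is symmetric under the reflection in the diagonal. -/
theorem lastLeft_eq_lastBelow_swap : lastLeft p j s = lastBelow (fun k => (p k).swap) j s := rfl

open Classical in
/-- The set of colors of the horizontal lines through the point `(s, (p j).2)`. -/
noncomputable def horizontalColors (p : ℕ → ℝ × ℝ)
    (ξ : ℕ × ℕ → Finset ℤ → Finset ℤ → Finset ℤ × Finset ℤ) (j : ℕ) (s : ℝ) : Finset ℤ :=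
  if (p j).1 < s then (lines p ξ (lastLeft p j s) j).2 else ∅

theorem lines_self : lines p ξ i i = ({color (p i)}, {color (p i)}) := by
  rw [lines, dif_neg fun h => lt_irrefl _ h.1, if_pos rfl]

theorem lines_vertex (hx : (p j).1 < (p i).1) (hy : (p i).2 < (p j).2)
    (hf : (lowerLeft p i j).Finite) :
    lines p ξ i j =
      ξ (i, j) (verticalColors p ξ i (p j).2) (horizontalColors p ξ j (p i).1) := by
  rw [lines, dif_pos ⟨hx, hy, hf⟩, verticalColors, if_pos hy, horizontalColors, if_pos hx]

theorem verticalColors_congr (hs : s ≤ s')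
    (h : ∀ k, (p k).1 ≤ (p i).1 → (p i).2 ≤ (p k).2 → (p k).2 < s' → (p k).2 < s) :
    verticalColors p ξ i s' = verticalColors p ξ i s := by
  unfold verticalColors
  rw [lastBelow_congr hs h]
  by_cases h1 : (p i).2 < s'
  · rw [if_pos h1, if_pos (h i le_rfl le_rfl h1)]
  · rw [if_neg h1, if_neg fun h2 => h1 (h2.trans_le hs)]

theorem horizontalColors_congr (hs : s ≤ s')
    (h : ∀ k, (p k).2 ≤ (p j).2 → (p j).1 ≤ (p k).1 → (p k).1 < s' → (p k).1 < s) :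
    horizontalColors p ξ j s' = horizontalColors p ξ j s := by
  unfold horizontalColors
  rw [lastLeft_eq_lastBelow_swap, lastLeft_eq_lastBelow_swap,
    lastBelow_congr (p := fun k => (p k).swap) hs h]
  by_cases h1 : (p j).1 < s'
  · rw [if_pos h1, if_pos (h j le_rfl le_rfl h1)]
  · rw [if_neg h1, if_neg fun h2 => h1 (h2.trans_le hs)]

end Lines

/-! ### Discretization of a configuration -/

/-- The column, in the grid of mesh `1 / D`, that contains the point `z`. -/
noncomputable def column (D : ℕ) (z : ℝ × ℝ) : ℕ := ⌊D * z.1⌋₊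

/-- The row, in the grid of mesh `1 / D`, that contains the point `z`. -/
noncomputable def row (D : ℕ) (z : ℝ × ℝ) : ℕ := ⌊D * z.2⌋₊

/-- The square `[0, N)²`, in terms of the grid of mesh `1 / D`. -/
def square (N D : ℕ) : Set (ℝ × ℝ) := {z | column D z < N * D ∧ row D z < N * D}

/-- The points lie in the open quadrant and avoid the lines with an integer coordinate, and the grid
of mesh `1 / D` has at most one point of `[0, N)²` in each of its rows and columns. -/
structure Separated (p : ℕ → ℝ × ℝ) (N D : ℕ) : Prop where
  pos : ∀ i, 0 < (p i).1 ∧ 0 < (p i).2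
  ne_nat : ∀ i (n : ℕ), (p i).1 ≠ n ∧ (p i).2 ≠ n
  column_inj : ∀ i j, p i ∈ square N D → p j ∈ square N D → column D (p i) = column D (p j) → i = j
  row_inj : ∀ i j, p i ∈ square N D → p j ∈ square N D → row D (p i) = row D (p j) → i = j

/-- The index of the point of `[0, N)²` in the column `a`. -/
noncomputable def colIdx (N D : ℕ) (p : ℕ → ℝ × ℝ) (a : ℕ) : ℕ :=
  sInf {i | p i ∈ square N D ∧ column D (p i) = a}

/-- The index of the point of `[0, N)²` in the row `b`. -/
noncomputable def rowIdx (N D : ℕ) (p : ℕ → ℝ × ℝ) (b : ℕ) : ℕ :=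
  sInf {i | p i ∈ square N D ∧ row D (p i) = b}

open Classical in
/-- Whether there is a point in the cell in row `b` and column `a`. -/
noncomputable def occupied (D : ℕ) (p : ℕ → ℝ × ℝ) (b a : ℕ) : Bool :=
  decide (∃ i, row D (p i) = b ∧ column D (p i) = a)

section Discretization

variable {p : ℕ → ℝ × ℝ} {ξ : ℕ × ℕ → Finset ℤ → Finset ℤ → Finset ℤ × Finset ℤ} {N D : ℕ}

theorem occupied_eq_true {b a : ℕ} :
    occupied D p b a = true ↔ ∃ i, row D (p i) = b ∧ column D (p i) = a := by
  simp [occupied]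

theorem fst_lt_div_iff (hD : 0 < D) {z : ℝ × ℝ} (hz : 0 < z.1) (a : ℕ) :
    z.1 < a / D ↔ column D z < a := by
  rw [column, Nat.floor_lt (by positivity), lt_div_iff₀ (by positivity), mul_comm]

theorem snd_lt_div_iff (hD : 0 < D) {z : ℝ × ℝ} (hz : 0 < z.2) (a : ℕ) :
    z.2 < a / D ↔ row D z < a := by
  rw [row, Nat.floor_lt (by positivity), lt_div_iff₀ (by positivity), mul_comm]

theorem color_eq_cellColor (hD : 0 < D) {z : ℝ × ℝ} (h1 : 0 < z.1) (h2 : 0 < z.2) :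
    color z = cellColor D (row D z) (column D z) := by
  have key : ∀ x : ℝ, 0 < x → ⌊x⌋ = ((⌊D * x⌋₊ / D : ℕ) : ℤ) := by
    intro x hx
    rw [← Nat.floor_div_natCast, mul_div_cancel_left₀ _ (by positivity),
      Int.natCast_floor_eq_floor hx.le]
  unfold color cellColor row column
  rw [key _ h1, key _ h2, min_comm]
  push_cast
  rw [min_add_add_right]

theorem column_mono (D : ℕ) {z w : ℝ × ℝ} (hij : z.1 ≤ w.1) : column D z ≤ column D w :=
  Nat.floor_le_floor (by gcongr)

theorem row_mono (D : ℕ) {z w : ℝ × ℝ} (hij : z.2 ≤ w.2) : row D z ≤ row D w :=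
  Nat.floor_le_floor (by gcongr)

theorem fst_lt_of_column_lt {z w : ℝ × ℝ} (h : column D z < column D w) : z.1 < w.1 := by
  by_contra hc
  exact absurd (column_mono D (not_lt.mp hc)) (not_le.mpr h)

theorem snd_lt_of_row_lt {z w : ℝ × ℝ} (h : row D z < row D w) : z.2 < w.2 := by
  by_contra hc
  exact absurd (row_mono D (not_lt.mp hc)) (not_le.mpr h)

namespace Separated

variable (h : Separated p N D) (hD : 0 < D)
include h

theorem colIdx_column {i : ℕ} (hi : p i ∈ square N D) : colIdx N D p (column D (p i)) = i := by
  have : {j | p j ∈ square N D ∧ column D (p j) = column D (p i)} = {i} := by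
    ext j
    refine ⟨fun hj => h.column_inj j i hj.1 hi hj.2, ?_⟩
    rintro rfl
    exact ⟨hi, rfl⟩
  rw [colIdx, this, csInf_singleton]

theorem rowIdx_row {i : ℕ} (hi : p i ∈ square N D) : rowIdx N D p (row D (p i)) = i := by
  have : {j | p j ∈ square N D ∧ row D (p j) = row D (p i)} = {i} := by
    ext j
    refine ⟨fun hj => h.row_inj j i hj.1 hi hj.2, ?_⟩
    rintro rfl
    exact ⟨hi, rfl⟩
  rw [rowIdx, this, csInf_singleton]

theorem finite_square : {i | p i ∈ square N D}.Finite :=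
  Set.Finite.of_finite_image ((Set.finite_lt_nat (N * D)).subset
    (by rintro _ ⟨i, hi, rfl⟩; exact hi.1)) fun i hi j hj => h.column_inj i j hi hj

include hD

/-- A vertical line stays unchanged across a row in which no point lies to its left. -/
theorem verticalColors_succ_of_forall {i b : ℕ} (hi : p i ∈ square N D) (hb : b < N * D)
    (hn : ∀ k, p k ∈ square N D → row D (p k) = b → row D (p i) ≤ b →
      ¬ column D (p k) ≤ column D (p i)) :
    verticalColors p ξ i ((b + 1 : ℕ) / D) = verticalColors p ξ i (b / D) := by
  refine verticalColors_congr (by gcongr; omega) fun k k1 k2 k3 => ?_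
  rw [snd_lt_div_iff hD (h.pos k).2] at k3 ⊢
  have h1 := column_mono D k1
  have h2 := row_mono D k2
  have hk : p k ∈ square N D := ⟨h1.trans_lt hi.1, by omega⟩
  by_contra hc
  exact hn k hk (by omega) (by omega) h1

theorem horizontalColors_succ_of_forall {j a : ℕ} (hj : p j ∈ square N D) (ha : a < N * D)
    (hn : ∀ k, p k ∈ square N D → column D (p k) = a → column D (p j) ≤ a →
      ¬ row D (p k) ≤ row D (p j)) :
    horizontalColors p ξ j ((a + 1 : ℕ) / D) = horizontalColors p ξ j (a / D) := by
  refine horizontalColors_congr (by gcongr; omega) fun k k1 k2 k3 => ?_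
  rw [fst_lt_div_iff hD (h.pos k).1] at k3 ⊢
  have h1 := row_mono D k1
  have h2 := column_mono D k2
  have hk : p k ∈ square N D := ⟨by omega, h1.trans_lt hj.2⟩
  by_contra hc
  exact hn k hk (by omega) (by omega) h1

/-- The colors above a point of the row `b` that lies on, or to the left of, the axis of `p i`. -/
theorem verticalColors_succ {i j : ℕ} (hi : p i ∈ square N D) (hj : p j ∈ square N D)
    (hc : column D (p j) ≤ column D (p i)) (hr : row D (p i) ≤ row D (p j)) :
    verticalColors p ξ i ((row D (p j) + 1 : ℕ) / D) = (lines p ξ i j).1 := by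
  have hle : (p j).1 ≤ (p i).1 ∧ (p i).2 ≤ (p j).2 := by
    rcases eq_or_ne i j with rfl | hne
    · exact ⟨le_rfl, le_rfl⟩
    · have hc' := lt_of_le_of_ne hc fun e => hne (h.column_inj _ _ hi hj e.symm)
      have hr' := lt_of_le_of_ne hr fun e => hne (h.row_inj _ _ hi hj e)
      exact ⟨(fst_lt_of_column_lt hc').le, (snd_lt_of_row_lt hr').le⟩
  rw [verticalColors, if_pos ((snd_lt_div_iff hD (h.pos i).2 _).mpr (by omega)),
    lastBelow_eq hle.1 hle.2 ((snd_lt_div_iff hD (h.pos j).2 _).mpr (by omega))]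
  intro k k1 k2 k3
  rw [snd_lt_div_iff hD (h.pos k).2] at k2
  have h1 := column_mono D k1
  have hk : p k ∈ square N D := ⟨h1.trans_lt hi.1, by have := hj.2; omega⟩
  exact snd_lt_of_row_lt (lt_of_le_of_ne (by omega) fun e => k3 (h.row_inj _ _ hk hj e))

theorem horizontalColors_succ {i j : ℕ} (hi : p i ∈ square N D) (hj : p j ∈ square N D)
    (hc : column D (p j) ≤ column D (p i)) (hr : row D (p i) ≤ row D (p j)) :
    horizontalColors p ξ j ((column D (p i) + 1 : ℕ) / D) = (lines p ξ i j).2 := by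
  have hle : (p j).1 ≤ (p i).1 ∧ (p i).2 ≤ (p j).2 := by
    rcases eq_or_ne i j with rfl | hne
    · exact ⟨le_rfl, le_rfl⟩
    · have hc' := lt_of_le_of_ne hc fun e => hne (h.column_inj _ _ hi hj e.symm)
      have hr' := lt_of_le_of_ne hr fun e => hne (h.row_inj _ _ hi hj e)
      exact ⟨(fst_lt_of_column_lt hc').le, (snd_lt_of_row_lt hr').le⟩
  rw [horizontalColors, if_pos ((fst_lt_div_iff hD (h.pos j).1 _).mpr (by omega)),
    lastLeft_eq_lastBelow_swap,
    lastBelow_eq (p := fun k => (p k).swap) hle.2 hle.1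
      ((fst_lt_div_iff hD (h.pos i).1 _).mpr (by omega))]
  intro k k1 k2 k3
  replace k2 := (fst_lt_div_iff hD (h.pos k).1 _).mp k2
  have h1 := row_mono D k1
  have hk : p k ∈ square N D := ⟨by have := hi.1; omega, h1.trans_lt hj.2⟩
  exact fst_lt_of_column_lt (lt_of_le_of_ne (by omega) fun e => k3 (h.column_inj _ _ hk hi e))

/-- Within a row that contains `p j`, a vertical line changes only at the height of `p j`. -/
theorem verticalColors_snd {i j : ℕ} (hi : p i ∈ square N D) (hj : p j ∈ square N D) :
    verticalColors p ξ i (p j).2 = verticalColors p ξ i (row D (p j) / D) := by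
  refine verticalColors_congr ?_ fun k k1 _ k3 => ?_
  · rw [div_le_iff₀ (by positivity), mul_comm]
    exact Nat.floor_le (by have := (h.pos j).2; positivity)
  · rw [snd_lt_div_iff hD (h.pos k).2]
    have h1 := column_mono D k1
    have h2 := row_mono D k3.le
    have hk : p k ∈ square N D := ⟨h1.trans_lt hi.1, h2.trans_lt hj.2⟩
    refine lt_of_le_of_ne h2 fun e => ?_
    rw [h.row_inj _ _ hk hj e] at k3
    exact lt_irrefl _ k3

theorem horizontalColors_fst {i j : ℕ} (hi : p i ∈ square N D) (hj : p j ∈ square N D) :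
    horizontalColors p ξ j (p i).1 = horizontalColors p ξ j (column D (p i) / D) := by
  refine horizontalColors_congr ?_ fun k k1 _ k3 => ?_
  · rw [div_le_iff₀ (by positivity), mul_comm]
    exact Nat.floor_le (by have := (h.pos i).1; positivity)
  · rw [fst_lt_div_iff hD (h.pos k).1]
    have h1 := row_mono D k1
    have h2 := column_mono D k3.le
    have hk : p k ∈ square N D := ⟨h2.trans_lt hi.1, h1.trans_lt hj.2⟩
    refine lt_of_le_of_ne h2 fun e => ?_
    rw [h.column_inj _ _ hk hi e] at k3
    exact lt_irrefl _ k3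

theorem lines_eq {i j : ℕ} (hi : p i ∈ square N D) (hj : p j ∈ square N D)
    (hc : column D (p j) < column D (p i)) (hr : row D (p i) < row D (p j)) :
    lines p ξ i j = ξ (i, j) (verticalColors p ξ i (row D (p j) / D))
      (horizontalColors p ξ j (column D (p i) / D)) := by
  have hf : (lowerLeft p i j).Finite := h.finite_square.subset fun k hk =>
    ⟨(column_mono D hk.1).trans_lt hi.1, (row_mono D hk.2).trans_lt hj.2⟩
  rw [lines_vertex (fst_lt_of_column_lt hc) (snd_lt_of_row_lt hr) hf, h.verticalColors_snd hD hi hj,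
    h.horizontalColors_fst hD hi hj]

end Separated

open Classical in
/-- The colors of the lines that enter the cell in row `b` and column `a` from the bottom. -/
noncomputable def realV (p : ℕ → ℝ × ℝ)
    (ξ : ℕ × ℕ → Finset ℤ → Finset ℤ → Finset ℤ × Finset ℤ) (N D b a : ℕ) : Finset ℤ :=
  if ∃ i, p i ∈ square N D ∧ column D (p i) = a then
    verticalColors p ξ (colIdx N D p a) (b / D) else ∅

open Classical in
/-- The colors of the lines that enter the cell in row `b` and column `a` from the left. -/
noncomputable def realH (p : ℕ → ℝ × ℝ)
    (ξ : ℕ × ℕ → Finset ℤ → Finset ℤ → Finset ℤ × Finset ℤ) (N D b a : ℕ) : Finset ℤ :=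
  if ∃ i, p i ∈ square N D ∧ row D (p i) = b then
    horizontalColors p ξ (rowIdx N D p b) (a / D) else ∅

namespace Separated

variable (h : Separated p N D) (hD : 0 < D)
include h

theorem realV_column {i : ℕ} (hi : p i ∈ square N D) (b : ℕ) :
    realV p ξ N D b (column D (p i)) = verticalColors p ξ i (b / D) := by
  rw [realV, if_pos ⟨i, hi, rfl⟩, h.colIdx_column hi]

theorem realH_row {j : ℕ} (hj : p j ∈ square N D) (a : ℕ) :
    realH p ξ N D (row D (p j)) a = horizontalColors p ξ j (a / D) := by
  rw [realH, if_pos ⟨j, hj, rfl⟩, h.rowIdx_row hj]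

theorem occupied_separated {b a : ℕ} (hb : b < N * D) (ha : a < N * D)
    (hba : occupied D p b a = true) :
    (∀ b' < b, occupied D p b' a = false) ∧ ∀ a' < a, occupied D p b a' = false := by
  obtain ⟨i, rfl, rfl⟩ := occupied_eq_true.mp hba
  refine ⟨fun b' hb' => ?_, fun a' ha' => ?_⟩ <;> by_contra hc <;>
    obtain ⟨j, h1, h2⟩ := occupied_eq_true.mp (Bool.eq_true_of_not_eq_false hc)
  · have := h.column_inj j i ⟨by omega, by omega⟩ ⟨ha, hb⟩ h2
    subst this
    omega
  · have := h.row_inj j i ⟨by omega, by omega⟩ ⟨ha, hb⟩ h1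
    subst this
    omega

include hD

/-- The lines obey the local rules of the grid model. -/
theorem real_eq_cellRule {b a : ℕ} (hb : b < N * D) (ha : a < N * D) :
    (realV p ξ N D (b + 1) a, realH p ξ N D b (a + 1)) =
      cellRule D (occupied D p) (fun b a => ξ (colIdx N D p a, rowIdx N D p b)) b a
        (realV p ξ N D b a) (realH p ξ N D b a) := by
  unfold cellRule
  by_cases hc : occupied D p b a = true
  · obtain ⟨i, rfl, rfl⟩ := occupied_eq_true.mp hc
    have hi : p i ∈ square N D := ⟨ha, hb⟩
    rw [if_pos hc, h.realV_column hi, h.realH_row hi, h.verticalColors_succ hD hi hi le_rfl le_rfl,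
      h.horizontalColors_succ hD hi hi le_rfl le_rfl, lines_self,
      color_eq_cellColor hD (h.pos i).1 (h.pos i).2]
  rw [if_neg hc]
  rw [occupied_eq_true, not_exists] at hc
  by_cases hm : Meets (occupied D p) b a
  · rw [if_pos hm]
    obtain ⟨⟨b', hb', h1⟩, a', ha', h2⟩ := hm
    obtain ⟨i, rfl, rfl⟩ := occupied_eq_true.mp h1
    obtain ⟨j, rfl, rfl⟩ := occupied_eq_true.mp h2
    have hi : p i ∈ square N D := ⟨ha, hb'.trans hb⟩
    have hj : p j ∈ square N D := ⟨ha'.trans ha, hb⟩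
    rw [h.realV_column hi, h.realV_column hi, h.realH_row hj, h.realH_row hj,
      h.verticalColors_succ hD hi hj ha'.le hb'.le, h.horizontalColors_succ hD hi hj ha'.le hb'.le]
    dsimp only
    rw [h.colIdx_column hi, h.rowIdx_row hj, h.lines_eq hD hi hj ha' hb']
  · rw [if_neg hm]
    congr 1
    · by_cases hV : ∃ i, p i ∈ square N D ∧ column D (p i) = a
      · obtain ⟨i, hi, rfl⟩ := hV
        rw [h.realV_column hi, h.realV_column hi, h.verticalColors_succ_of_forall hD hi hb]
        rintro k hk rfl hir hkc
        have h1 : column D (p k) ≠ column D (p i) := fun e => hc k ⟨rfl, e⟩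
        have h2 : row D (p i) ≠ row D (p k) := fun e => hc i ⟨e, rfl⟩
        exact hm ⟨⟨row D (p i), by omega, occupied_eq_true.mpr ⟨i, rfl, rfl⟩⟩,
          column D (p k), by omega, occupied_eq_true.mpr ⟨k, rfl, rfl⟩⟩
      · rw [realV, if_neg hV, realV, if_neg hV]
    · by_cases hH : ∃ j, p j ∈ square N D ∧ row D (p j) = b
      · obtain ⟨j, hj, rfl⟩ := hH
        rw [h.realH_row hj, h.realH_row hj, h.horizontalColors_succ_of_forall hD hj ha]
        rintro k hk rfl hjc hkr
        have h1 : row D (p k) ≠ row D (p j) := fun e => hc k ⟨e, rfl⟩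
        have h2 : column D (p j) ≠ column D (p k) := fun e => hc j ⟨rfl, e⟩
        exact hm ⟨⟨row D (p k), by omega, occupied_eq_true.mpr ⟨k, rfl, rfl⟩⟩,
          column D (p j), by omega, occupied_eq_true.mpr ⟨j, rfl, rfl⟩⟩
      · rw [realH, if_neg hH, realH, if_neg hH]

/-- The lines of the model, seen on a grid that separates the nucleations, are those of the grid
model. -/
theorem realV_eq_colV {b a : ℕ} (hb : b ≤ N * D) (ha : a < N * D) :
    realV p ξ N D b a =
      colV D (occupied D p) (fun b a => ξ (colIdx N D p a, rowIdx N D p b)) b a := by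
  refine (grid_unique (K := N * D) (V := realV p ξ N D) (H := realH p ξ N D) ?_ ?_
    fun b hb a ha => h.real_eq_cellRule hD hb ha).1 b hb a ha
  · intro a _
    have h0 : ∀ i, verticalColors p ξ i ((0 : ℕ) / D) = ∅ := fun i => if_neg (by
      rw [Nat.cast_zero, zero_div]
      exact not_lt.mpr (h.pos _).2.le)
    rw [realV, h0, ite_self]
  · intro b _
    have h0 : ∀ i, horizontalColors p ξ i ((0 : ℕ) / D) = ∅ := fun i => if_neg (by
      rw [Nat.cast_zero, zero_div]
      exact not_lt.mpr (h.pos _).1.le)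
    rw [realH, h0, ite_self]

theorem X_eq_gridX (hξ : ∀ v x y, ∃ coin, ξ v x y = outcome coin x y) {m n : ℕ} (hn : n ≤ N) :
    X p ξ m n = gridX D
      (colV D (occupied D p) fun b a => ξ (colIdx N D p a, rowIdx N D p b)) m n := by
  set V := colV D (occupied D p) fun b a => ξ (colIdx N D p a, rowIdx N D p b) with hV
  have hK : n * D ≤ N * D := Nat.mul_le_mul_right D hn
  have hdiv : ((n * D : ℕ) : ℝ) / D = n := by
    rw [Nat.cast_mul, mul_div_cancel_right₀ _ (by positivity)]
  have hdivm : ((m * D : ℕ) : ℝ) / D = m := by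
    rw [Nat.cast_mul, mul_div_cancel_right₀ _ (by positivity)]
  -- the points whose vertical lines reach the segment
  let T : Set ℕ := {i | m * D ≤ column D (p i) ∧ column D (p i) < n * D ∧ row D (p i) < n * D}
  have hTsq : ∀ i ∈ T, p i ∈ square N D := fun i hi => ⟨hi.2.1.trans_le hK, hi.2.2.trans_le hK⟩
  have hT : T.Finite := h.finite_square.subset hTsq
  have hcol : ∀ i ∈ T, verticalColors p ξ i n = V (n * D) (column D (p i)) := by
    intro i hi
    rw [hV, ← h.realV_eq_colV hD hK (hTsq i hi).1, h.realV_column (hTsq i hi), hdiv]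
  have hfilter : ∀ a, ((V (n * D) a).filter fun c => -(n : ℤ) ≤ c ∧ c ≤ -(m : ℤ) - 1).card % 2 =
      proj (-(m : ℤ) - 1) (V (n * D) a) := by
    intro a
    rw [proj]
    congr 2
    refine Finset.filter_congr fun s hs => ?_
    obtain ⟨b', hb', a', -, rfl⟩ := (exists_cellColor (fun b a x y => hξ _ x y) (n * D) a).1 s hs
    exact and_iff_right (neg_le_cellColor (Or.inl hb'))
  have hX : X p ξ m n = ∑ i ∈ hT.toFinset, ((((verticalColors p ξ i n).filter
      fun c => -(n : ℤ) ≤ c ∧ c ≤ -(m : ℤ) - 1).card % 2 : ℕ) : ℝ) := by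
    refine finsum_mem_eq_sum_of_inter_support_eq _ ?_
    ext i
    rw [Set.Finite.coe_toFinset]
    refine and_congr_left fun hi => ?_
    rw [Set.mem_ofPred_eq, Set.mem_ofPred_eq, ← not_lt, ← not_lt (a := column D _),
      ← fst_lt_div_iff hD (h.pos i).1, ← fst_lt_div_iff hD (h.pos i).1,
      ← snd_lt_div_iff hD (h.pos i).2, hdiv, hdivm, not_lt]
    refine and_congr_right fun _ =>
      ⟨fun h1 => ⟨lt_of_le_of_ne h1 (h.ne_nat i n).1, ?_⟩, fun h1 => h1.1.le⟩
    by_contra h2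
    exact hi (by simp [verticalColors, h2])
  rw [hX, Finset.sum_congr rfl fun i hi => by
    rw [hcol i (hT.mem_toFinset.mp hi), hfilter], ← Nat.cast_sum, Nat.cast_inj, gridX,
    ← Finset.sum_image (f := fun a => proj (-(m : ℤ) - 1) (V (n * D) a))
      (g := fun i => column D (p i))]
  · refine Finset.sum_subset ?_ fun a ha hna => ?_
    · intro a ha
      obtain ⟨i, hi, rfl⟩ := Finset.mem_image.mp ha
      have hi := hT.mem_toFinset.mp hi
      exact Finset.mem_Ico.mpr ⟨hi.1, hi.2.1⟩
    · rw [Finset.mem_Ico] at ha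
      have haN := ha.2.trans_le hK
      rw [hV, ← h.realV_eq_colV hD hK haN]
      by_cases hi : ∃ i, p i ∈ square N D ∧ column D (p i) = a
      · obtain ⟨i, hi, rfl⟩ := hi
        rw [h.realV_column hi, verticalColors, if_neg, proj_empty]
        rw [snd_lt_div_iff hD (h.pos i).2]
        exact fun h1 => hna (Finset.mem_image.mpr
          ⟨i, hT.mem_toFinset.mpr ⟨ha.1, ha.2, h1⟩, rfl⟩)
      · rw [realV, if_neg hi, proj_empty]
  · intro i hi j hj
    exact h.column_inj i j (hTsq i (hT.mem_toFinset.mp hi)) (hTsq j (hT.mem_toFinset.mp hj))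

theorem X_add_le (hξ : ∀ v x y, ∃ coin, ξ v x y = outcome coin x y) {m n : ℕ} (hmn : m ≤ n)
    (hn : n ≤ N) : X p ξ 0 m + X p ξ m n ≤ X p ξ 0 n := by
  rw [h.X_eq_gridX hD hξ (hmn.trans hn), h.X_eq_gridX hD hξ hn, h.X_eq_gridX hD hξ hn]
  have hK : n * D ≤ N * D := Nat.mul_le_mul_right D hn
  exact_mod_cast gridX_add_le hD (fun b a x y => hξ _ x y) hmn fun b hb a ha =>
    h.occupied_separated (hb.trans_le hK) (ha.trans_le hK)

end Separated

end Discretization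

/-! ### The law of the outcome of a vertex -/

/-- The law of a coin that shows `true` with probability `t`. -/
noncomputable def coinMeasure (t : unitInterval) : Measure Bool :=
  ENNReal.ofReal t • Measure.dirac true + ENNReal.ofReal (1 - t) • Measure.dirac false

instance (t : unitInterval) : IsProbabilityMeasure (coinMeasure t) := by
  constructor
  rw [coinMeasure, Measure.add_apply, Measure.smul_apply, Measure.smul_apply, measure_univ,
    measure_univ, smul_eq_mul, smul_eq_mul, mul_one, mul_one,
    ← ENNReal.ofReal_add t.2.1 (sub_nonneg.mpr t.2.2), add_sub_cancel, ENNReal.ofReal_one]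

section Outcome

variable {Ω : Type*} [MeasurableSpace Ω] {P : Measure Ω} [IsProbabilityMeasure P]
  {t : unitInterval} {f : Ω → Finset ℤ × Finset ℤ} {x y : Finset ℤ}

/-- The weights of the two outcomes of a coin add up to `1`, so that the law of the outcome of a
vertex is determined by these two weights. -/
theorem ae_exists_outcome (hf : Measurable f)
    (hlaw : ∀ k l, k ⊆ x ∪ y → l ⊆ x ∪ y →
      P {ω | f ω = (k, l)} = ENNReal.ofReal (L t (x ∪ y) x y k l)) :
    (∀ᵐ ω ∂P, ∃ coin, f ω = outcome coin x y) ∧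
      ∀ q, P {ω | f ω = q} = coinMeasure t {coin | outcome coin x y = q} := by
  have hm : ∀ q, MeasurableSet {ω | f ω = q} := fun q => hf (measurableSet_singleton q)
  have hpass := hlaw x y Finset.subset_union_left Finset.subset_union_right
  have hann := hlaw (annihilated x y) (annihilated y x) (annihilated_subset x y)
    ((annihilated_subset y x).trans (Finset.union_comm y x).subset)
  by_cases hr : ∃ r, proj r x = 1 ∧ proj r y = 1
  · obtain ⟨r, hx, hy⟩ := hr
    rw [L_pass t hx hy] at hpass
    rw [L_annihilate t hx hy] at hann
    have hne : (annihilated x y, annihilated y x) ≠ (x, y) := fun h =>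
      annihilated_ne_left hx hy (Prod.ext_iff.mp h).1
    have hae : ∀ᵐ ω ∂P, ∃ coin, f ω = outcome coin x y := by
      have hset : {ω | ∃ coin, f ω = outcome coin x y} =
          {ω | f ω = (x, y)} ∪ {ω | f ω = (annihilated x y, annihilated y x)} := by
        ext ω
        simp [outcome, or_comm]
      have hdisj : Disjoint {ω | f ω = (x, y)}
          {ω | f ω = (annihilated x y, annihilated y x)} :=
        Set.disjoint_left.mpr fun ω h h' => hne (h'.symm.trans h)
      change {ω | ∃ coin, f ω = outcome coin x y} ∈ ae P
      rw [hset, mem_ae_iff_prob_eq_one ((hm _).union (hm _)), measure_union hdisj (hm _), hpass,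
        hann, ← ENNReal.ofReal_add t.2.1 (sub_nonneg.mpr t.2.2), add_sub_cancel, ENNReal.ofReal_one]
    refine ⟨hae, fun q => ?_⟩
    by_cases h2 : q = (x, y)
    · subst h2
      simp [hpass, coinMeasure, outcome, hne]
    by_cases h3 : q = (annihilated x y, annihilated y x)
    · subst h3
      simp [hann, coinMeasure, outcome, hne.symm]
    · have hempty : {coin | outcome coin x y = q} = ∅ := by
        ext coin
        cases coin <;> simp [outcome, Ne.symm h2, Ne.symm h3]
      rw [hempty, measure_empty]
      refine measure_mono_null (fun ω hω => ?_) (ae_iff.mp hae)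
      rintro ⟨coin, hc⟩
      rw [Set.mem_ofPred_eq] at hω
      rw [hω] at hc
      cases coin
      · exact h3 hc
      · exact h2 hc
  · have hr' : ∀ r, proj r x = 1 → proj r y ≠ 1 := fun r h h' => hr ⟨r, h, h'⟩
    have hout : ∀ coin, outcome coin x y = (x, y) := by
      intro coin
      cases coin
      · simp [outcome, annihilated_eq_left hr',
          annihilated_eq_left fun r h h' => hr' r h' h]
      · rfl
    rw [L_pass_of_forall t hr', ENNReal.ofReal_one] at hpass
    have hae : ∀ᵐ ω ∂P, f ω = (x, y) := (mem_ae_iff_prob_eq_one (hm _)).mpr hpass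
    refine ⟨by simpa [hout] using hae, fun q => ?_⟩
    simp only [hout]
    by_cases h2 : (x, y) = q
    · subst h2
      rw [hpass]
      simp only [Set.ofPred_true, measure_univ]
    · simp only [h2, Set.ofPred_false, measure_empty]
      refine measure_mono_null (fun ω hω => ?_) (ae_iff.mp hae)
      rw [Set.mem_ofPred_eq] at hω
      exact fun h => h2 (h.symm.trans hω)

end Outcome

/-! ### Counts of a Poisson process -/

theorem one_sub_exp_neg_mul_le {x : ℝ} (hx : 0 ≤ x) :
    1 - (Real.exp (-x) + Real.exp (-x) * x) ≤ x ^ 2 := by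
  have := mul_le_mul_of_nonneg_right (Real.one_sub_le_exp_neg x) (by linarith : 0 ≤ 1 + x)
  nlinarith

theorem poissonMeasure_one_lt_le (r : NNReal) :
    poissonMeasure r {n | 1 < n} ≤ ENNReal.ofReal ((r : ℝ) ^ 2) := by
  have hset : {n : ℕ | 1 < n} = ({0, 1} : Set ℕ)ᶜ := by
    ext n
    simp
    omega
  have h01 : ({0, 1} : Set ℕ) = {0} ∪ {1} := by ext; simp [or_comm]
  rw [hset, prob_compl_eq_one_sub (Set.toFinite _).measurableSet, h01,
    measure_union (by simp) (measurableSet_singleton _), poissonMeasure_singleton,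
    poissonMeasure_singleton, ← ENNReal.ofReal_add (by positivity) (by positivity),
    ← ENNReal.ofReal_one, ← ENNReal.ofReal_sub _ (by positivity)]
  refine ENNReal.ofReal_le_ofReal ?_
  simpa using one_sub_exp_neg_mul_le r.coe_nonneg

namespace IsPoissonProcess

variable {Ω E : Type*} [MeasurableSpace Ω] [MeasurableSpace E] {P : Measure Ω}
  {ν : Measure E} {p : ℕ → Ω → E} (h : IsPoissonProcess P ν p) {A : Set E} (hA : MeasurableSet A)
include h hA

theorem measure_count (hν : ν A ≠ ⊤) (q : ℕ∞ → Prop) :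
    P {ω | q {i | p i ω ∈ A}.encard} = poissonMeasure (ν A).toNNReal {n : ℕ | q n} := by
  rw [(h.hasLaw A hA hν).measure_eq (p := q) (MeasurableSet.of_discrete),
    Measure.map_apply (measurable_of_countable _) (MeasurableSet.of_discrete)]
  rfl

theorem measure_one_lt_count_le (hν : ν A ≠ ⊤) :
    P {ω | 1 < {i | p i ω ∈ A}.encard} ≤ ENNReal.ofReal ((ν A).toReal ^ 2) := by
  rw [h.measure_count hA hν (fun n => 1 < n)]
  simpa only [Nat.one_lt_cast] using! poissonMeasure_one_lt_le (ν A).toNNReal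

theorem ae_forall_notMem [IsProbabilityMeasure P] (hν : ν A = 0) : ∀ᵐ ω ∂P, ∀ i, p i ω ∉ A := by
  have h1 := h.measure_count hA (by simp [hν]) (fun n => n = 0)
  have hset : {n : ℕ | (n : ℕ∞) = 0} = {0} := by ext; simp
  simp only [hset, hν, poissonMeasure_singleton, ENNReal.toNNReal_zero, NNReal.coe_zero, neg_zero,
    Real.exp_zero, pow_zero, mul_one, Nat.factorial_zero, Nat.cast_one, div_one,
    ENNReal.ofReal_one, Set.encard_eq_zero] at h1
  have hset' : {ω | {i | p i ω ∈ A} = ∅} = {ω | ∀ i, p i ω ∉ A} := by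
    ext ω
    simp [Set.eq_empty_iff_forall_notMem]
  rw [hset'] at h1
  refine (mem_ae_iff_prob_eq_one ?_).mpr h1
  rw [Set.ofPred_forall]
  exact MeasurableSet.iInter fun i => (h.measurable i hA).compl

end IsPoissonProcess

/-! ### The grid separates the nucleations with high probability -/

/-- The intensity of the nucleations: Lebesgue measure on the open quadrant. -/
noncomputable abbrev intensity : Measure (ℝ × ℝ) :=
  volume.restrict (Set.Ioi (0 : ℝ) ×ˢ Set.Ioi (0 : ℝ))

theorem measurable_column (D : ℕ) : Measurable (column D) := by
  unfold column
  fun_prop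

theorem measurable_row (D : ℕ) : Measurable (row D) := by
  unfold row
  fun_prop

theorem volume_floor_eq {D : ℕ} (hD : 0 < D) (a : ℕ) :
    volume ({x : ℝ | ⌊D * x⌋₊ = a} ∩ Set.Ioi 0) = ENNReal.ofReal (1 / D) := by
  have hD' : (0 : ℝ) < D := by positivity
  have hlen : ((a + 1 : ℕ) : ℝ) / D - a / D = 1 / D := by
    push_cast
    ring
  refine le_antisymm ?_ ?_
  · rw [← hlen, ← Real.volume_Ico]
    refine measure_mono fun x hx => ?_
    have h0 : (0 : ℝ) ≤ D * x := mul_nonneg hD'.le (le_of_lt hx.2)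
    obtain ⟨h1, h2⟩ := (Nat.floor_eq_iff h0).mp hx.1
    refine ⟨?_, ?_⟩
    · rwa [div_le_iff₀ hD', mul_comm]
    · rw [lt_div_iff₀ hD', mul_comm]
      exact_mod_cast h2
  · rw [← hlen, ← Real.volume_Ioo]
    refine measure_mono fun x hx => ?_
    have h0 : 0 < x := lt_of_le_of_lt (by positivity) hx.1
    refine ⟨(Nat.floor_eq_iff (by positivity)).mpr ⟨?_, ?_⟩, h0⟩
    · have := (div_lt_iff₀ hD').mp hx.1
      linarith
    · have := (lt_div_iff₀ hD').mp hx.2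
      push_cast at this
      linarith

theorem volume_floor_lt {D : ℕ} (hD : 0 < D) (N : ℕ) :
    volume ({x : ℝ | ⌊D * x⌋₊ < N * D} ∩ Set.Ioi 0) ≤ ENNReal.ofReal N := by
  have hD' : (0 : ℝ) < D := by positivity
  rw [← sub_zero (N : ℝ), ← Real.volume_Ico]
  refine measure_mono fun x hx => ⟨le_of_lt hx.2, ?_⟩
  have h0 : (0 : ℝ) ≤ D * x := mul_nonneg hD'.le (le_of_lt hx.2)
  have h1 : D * x < (N * D : ℕ) := (Nat.floor_lt h0).mp hx.1
  push_cast at h1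
  nlinarith

theorem intensity_prod (A B : Set ℝ) (hA : MeasurableSet A) (hB : MeasurableSet B) :
    intensity {z | z.1 ∈ A ∧ z.2 ∈ B} =
      volume (A ∩ Set.Ioi 0) * volume (B ∩ Set.Ioi 0) := by
  have : {z : ℝ × ℝ | z.1 ∈ A ∧ z.2 ∈ B} = A ×ˢ B := rfl
  rw [this, intensity, Measure.restrict_apply (hA.prod hB), Set.prod_inter_prod,
    Measure.volume_eq_prod, Measure.prod_prod]

theorem measurableSet_floor_eq (D a : ℕ) : MeasurableSet {x : ℝ | ⌊D * x⌋₊ = a} :=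
  (by fun_prop : Measurable fun x : ℝ => ⌊D * x⌋₊) (measurableSet_singleton a)

theorem measurableSet_floor_lt (D a : ℕ) : MeasurableSet {x : ℝ | ⌊D * x⌋₊ < a} :=
  (by fun_prop : Measurable fun x : ℝ => ⌊D * x⌋₊) (measurableSet_Iio (a := a))

theorem intensity_cell {D : ℕ} (hD : 0 < D) (b a : ℕ) :
    intensity {z | row D z = b ∧ column D z = a} =
      ENNReal.ofReal (1 / D) * ENNReal.ofReal (1 / D) := by
  simp_rw [and_comm (a := row D _ = b)]
  rw [← volume_floor_eq hD a]
  nth_rw 2 [volume_floor_eq hD a]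
  rw [← volume_floor_eq hD b]
  exact intensity_prod _ _ (measurableSet_floor_eq D a) (measurableSet_floor_eq D b)

theorem intensity_column_le {D : ℕ} (hD : 0 < D) (N a : ℕ) :
    intensity {z | column D z = a ∧ row D z < N * D} ≤ ENNReal.ofReal (N / D) := by
  refine (intensity_prod _ _ (measurableSet_floor_eq D a)
    (measurableSet_floor_lt D (N * D))).trans_le ?_
  rw [volume_floor_eq hD a, div_eq_mul_one_div (N : ℝ), mul_comm (N : ℝ),
    ENNReal.ofReal_mul (by positivity)]
  exact mul_le_mul_right (volume_floor_lt hD N) _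

theorem intensity_row_le {D : ℕ} (hD : 0 < D) (N b : ℕ) :
    intensity {z | column D z < N * D ∧ row D z = b} ≤ ENNReal.ofReal (N / D) := by
  refine (intensity_prod _ _ (measurableSet_floor_lt D (N * D))
    (measurableSet_floor_eq D b)).trans_le ?_
  rw [volume_floor_eq hD b, div_eq_mul_one_div (N : ℝ), ENNReal.ofReal_mul (by positivity)]
  exact mul_le_mul_left (volume_floor_lt hD N) _

section Separation

variable {Ω : Type*} [MeasurableSpace Ω] {P : Measure Ω} [IsProbabilityMeasure P]
  {p : ℕ → Ω → ℝ × ℝ}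

theorem ae_pos_and_ne_nat (h : IsPoissonProcess P intensity p) :
    ∀ᵐ ω ∂P, ∀ i, (0 < (p i ω).1 ∧ 0 < (p i ω).2) ∧
      ∀ n : ℕ, (p i ω).1 ≠ n ∧ (p i ω).2 ≠ n := by
  have hpos : ∀ᵐ ω ∂P, ∀ i, p i ω ∉ (Set.Ioi (0 : ℝ) ×ˢ Set.Ioi (0 : ℝ))ᶜ :=
    h.ae_forall_notMem (measurableSet_Ioi.prod measurableSet_Ioi).compl (by
      rw [intensity, Measure.restrict_apply (measurableSet_Ioi.prod measurableSet_Ioi).compl,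
        Set.compl_inter_self, measure_empty])
  have h1 : ∀ᵐ ω ∂P, ∀ (n : ℕ) (i),
      p i ω ∉ {z : ℝ × ℝ | z.1 ∈ ({(n : ℝ)} : Set ℝ) ∧ z.2 ∈ Set.univ} :=
    ae_all_iff.mpr fun n => h.ae_forall_notMem
      ((measurableSet_singleton _).prod MeasurableSet.univ) (by
      rw [intensity_prod _ _ (measurableSet_singleton _) MeasurableSet.univ,
        measure_mono_null Set.inter_subset_left Real.volume_singleton, zero_mul])
  have h2 : ∀ᵐ ω ∂P, ∀ (n : ℕ) (i),
      p i ω ∉ {z : ℝ × ℝ | z.1 ∈ Set.univ ∧ z.2 ∈ ({(n : ℝ)} : Set ℝ)} :=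
    ae_all_iff.mpr fun n => h.ae_forall_notMem
      (MeasurableSet.univ.prod (measurableSet_singleton _)) (by
      rw [intensity_prod _ _ MeasurableSet.univ (measurableSet_singleton _),
        measure_mono_null Set.inter_subset_left Real.volume_singleton, mul_zero])
  filter_upwards [hpos, h1, h2] with ω hpos h1 h2 i
  exact ⟨not_not.mp (hpos i), fun n => ⟨fun hn => h1 n i ⟨hn, trivial⟩,
    fun hn => h2 n i ⟨trivial, hn⟩⟩⟩

theorem measure_not_separated_le (h : IsPoissonProcess P intensity p) (N : ℕ) {D : ℕ}
    (hD : 0 < D) :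
    P {ω | ¬ Separated (fun i => p i ω) N D} ≤ ENNReal.ofReal (2 * N ^ 3 / D) := by
  set C : ℕ → Set Ω := fun a =>
    {ω | 1 < {i | p i ω ∈ {z | column D z = a ∧ row D z < N * D}}.encard}
  set R : ℕ → Set Ω := fun b =>
    {ω | 1 < {i | p i ω ∈ {z | column D z < N * D ∧ row D z = b}}.encard}
  have hC : ∀ a, P (C a) ≤ ENNReal.ofReal ((N / D) ^ 2) := by
    intro a
    have hle := intensity_column_le hD N a
    refine (h.measure_one_lt_count_le ((measurableSet_floor_eq D a).prod
      (measurableSet_floor_lt D (N * D))) (ne_top_of_le_ne_top ENNReal.ofReal_ne_top hle)).trans ?_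
    gcongr
    exact ENNReal.toReal_le_of_le_ofReal (by positivity) hle
  have hR : ∀ b, P (R b) ≤ ENNReal.ofReal ((N / D) ^ 2) := by
    intro b
    have hle := intensity_row_le hD N b
    refine (h.measure_one_lt_count_le ((measurableSet_floor_lt D (N * D)).prod
      (measurableSet_floor_eq D b)) (ne_top_of_le_ne_top ENNReal.ofReal_ne_top hle)).trans ?_
    gcongr
    exact ENNReal.toReal_le_of_le_ofReal (by positivity) hle
  have hsub : {ω | ¬ Separated (fun i => p i ω) N D} ≤ᵐ[P]
      ⋃ a ∈ Finset.range (N * D), (C a ∪ R a) := by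
    filter_upwards [ae_pos_and_ne_nat h] with ω hω hns
    by_contra hcon
    have hcon' : ∀ a < N * D, ω ∉ C a ∧ ω ∉ R a := by
      intro a ha
      rw [← not_or]
      exact fun h' => hcon (Set.mem_biUnion (Finset.mem_coe.mpr (Finset.mem_range.mpr ha)) h')
    refine hns ⟨fun i => (hω i).1, fun i => (hω i).2, fun i j hi hj hij => ?_,
      fun i j hi hj hij => ?_⟩
    · by_contra hne
      exact (hcon' _ hj.1).1 (Set.one_lt_encard_iff.mpr ⟨i, j, ⟨hij, hi.2⟩, ⟨rfl, hj.2⟩, hne⟩)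
    · by_contra hne
      exact (hcon' _ hj.2).2 (Set.one_lt_encard_iff.mpr ⟨i, j, ⟨hi.1, hij⟩, ⟨hj.1, rfl⟩, hne⟩)
  calc P {ω | ¬ Separated (fun i => p i ω) N D}
      ≤ P (⋃ a ∈ Finset.range (N * D), (C a ∪ R a)) := measure_mono_ae hsub
    _ ≤ ∑ a ∈ Finset.range (N * D), P (C a ∪ R a) := measure_biUnion_finset_le _ _
    _ ≤ ∑ a ∈ Finset.range (N * D), (ENNReal.ofReal ((N / D) ^ 2) + ENNReal.ofReal ((N / D) ^ 2)) :=
        Finset.sum_le_sum fun a _ => (measure_union_le _ _).trans (add_le_add (hC a) (hR a))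
    _ = ENNReal.ofReal (2 * N ^ 3 / D) := by
        rw [Finset.sum_const, Finset.card_range, nsmul_eq_mul,
          ← ENNReal.ofReal_add (by positivity) (by positivity), ← ENNReal.ofReal_natCast,
          ← ENNReal.ofReal_mul (by positivity)]
        congr 1
        push_cast
        field_simp
        ring

theorem measurableSet_separated (hp : ∀ i, Measurable (p i)) (N D : ℕ) :
    MeasurableSet {ω | Separated (fun i => p i ω) N D} := by
  have hc : ∀ i, Measurable fun ω => column D (p i ω) := fun i => (measurable_column D).comp (hp i)
  have hr : ∀ i, Measurable fun ω => row D (p i ω) := fun i => (measurable_row D).comp (hp i)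
  have h1 : ∀ i, Measurable fun ω => (p i ω).1 := fun i => (hp i).fst
  have h2 : ∀ i, Measurable fun ω => (p i ω).2 := fun i => (hp i).snd
  have hset : {ω | Separated (fun i => p i ω) N D} =
      {ω | (∀ i, 0 < (p i ω).1 ∧ 0 < (p i ω).2) ∧ (∀ i (n : ℕ), (p i ω).1 ≠ n ∧ (p i ω).2 ≠ n) ∧
        (∀ i j, p i ω ∈ square N D → p j ω ∈ square N D →
          column D (p i ω) = column D (p j ω) → i = j) ∧
        ∀ i j, p i ω ∈ square N D → p j ω ∈ square N D →
          row D (p i ω) = row D (p j ω) → i = j} := by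
    ext ω
    exact ⟨fun h => ⟨h.1, h.2, h.3, h.4⟩, fun h => ⟨h.1, h.2.1, h.2.2.1, h.2.2.2⟩⟩
  rw [hset]
  unfold square
  simp only [Set.mem_ofPred_eq]
  measurability

end Separation

/-! ### The law of the lines for given nucleations -/

/-- The states entering the cells from the bottom, if `q` are the states leaving them. -/
def inputV (q : ℕ × ℕ → Finset ℤ × Finset ℤ) : ℕ → ℕ → Finset ℤ
  | 0, _ => ∅
  | b + 1, a => (q (b, a)).1

/-- The states entering the cells from the left, if `q` are the states leaving them. -/
def inputH (q : ℕ × ℕ → Finset ℤ × Finset ℤ) (b : ℕ) : ℕ → Finset ℤ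
  | 0 => ∅
  | a + 1 => (q (b, a)).2

section Deterministic

variable {K D : ℕ} {c : ℕ → ℕ → Bool} {o : ℕ → ℕ → Finset ℤ → Finset ℤ → Finset ℤ × Finset ℤ}
  {q : ℕ × ℕ → Finset ℤ × Finset ℤ}

theorem colV_eq_inputV
    (h : ∀ b < K, ∀ a < K, (colV D c o (b + 1) a, colH D c o b (a + 1)) = q (b, a)) :
    (∀ b ≤ K, ∀ a < K, colV D c o b a = inputV q b a) ∧
      ∀ b < K, ∀ a ≤ K, colH D c o b a = inputH q b a := by
  refine ⟨fun b hb a ha => ?_, fun b hb a ha => ?_⟩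
  · cases b with
    | zero => rfl
    | succ b => rw [inputV, ← h b (by omega) a ha]
  · cases a with
    | zero => rfl
    | succ a => rw [inputH, ← h b hb a (by omega)]

/-- The lines take given values exactly if these values obey all the local rules. -/
theorem col_eq_iff :
    (∀ b < K, ∀ a < K, (colV D c o (b + 1) a, colH D c o b (a + 1)) = q (b, a)) ↔
      ∀ b < K, ∀ a < K, cellRule D c o b a (inputV q b a) (inputH q b a) = q (b, a) := by
  constructor
  · intro h b hb a ha
    have hin := colV_eq_inputV h
    rw [← hin.1 b hb.le a ha, ← hin.2 b hb a ha.le, ← h b hb a ha]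
    rfl
  · intro h b hb a ha
    obtain ⟨hV, hH⟩ := grid_unique (K := K) (z := ∅) (Φ := cellRule D c o) (V := inputV q)
      (H := inputH q) (fun _ _ => rfl) (fun _ _ => rfl) fun b hb a ha => (h b hb a ha).symm
    exact Prod.ext (hV (b + 1) hb a ha).symm (hH b hb (a + 1) ha).symm

open Classical in
/-- The cells of the square `[0, K)²` at which lines may meet. -/
noncomputable def vertices (K : ℕ) (c : ℕ → ℕ → Bool) : Finset (ℕ × ℕ) :=
  (Finset.range K ×ˢ Finset.range K).filter fun s => c s.1 s.2 = false ∧ Meets c s.1 s.2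

theorem mem_vertices {s : ℕ × ℕ} :
    s ∈ vertices K c ↔ (s.1 < K ∧ s.2 < K) ∧ c s.1 s.2 = false ∧ Meets c s.1 s.2 := by
  simp [vertices]

theorem cellRule_of_mem {b a : ℕ} (h : (b, a) ∈ vertices K c) (x y : Finset ℤ) :
    cellRule D c o b a x y = o b a x y := by
  obtain ⟨-, h1, h2⟩ := mem_vertices.mp h
  rw [cellRule, if_neg (by simpa using h1), if_pos h2]

/-- Outside the vertices, the local rule does not involve the outcomes. -/
theorem cellRule_of_notMem {b a : ℕ} (hb : b < K) (ha : a < K) (h : (b, a) ∉ vertices K c)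
    (o' : ℕ → ℕ → Finset ℤ → Finset ℤ → Finset ℤ × Finset ℤ) (x y : Finset ℤ) :
    cellRule D c o b a x y = cellRule D c o' b a x y := by
  unfold cellRule
  by_cases h1 : c b a = true
  · rw [if_pos h1, if_pos h1]
  · have h2 : ¬ Meets c b a := fun h2 => h (mem_vertices.mpr ⟨⟨hb, ha⟩, by simpa using h1, h2⟩)
    rw [if_neg h1, if_neg h1, if_neg h2, if_neg h2]

theorem col_eq_iff_vertices (o' : ℕ → ℕ → Finset ℤ → Finset ℤ → Finset ℤ × Finset ℤ) :
    (∀ b < K, ∀ a < K, (colV D c o (b + 1) a, colH D c o b (a + 1)) = q (b, a)) ↔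
      (∀ b < K, ∀ a < K, (b, a) ∉ vertices K c →
        cellRule D c o' b a (inputV q b a) (inputH q b a) = q (b, a)) ∧
      ∀ s ∈ vertices K c, o s.1 s.2 (inputV q s.1 s.2) (inputH q s.1 s.2) = q s := by
  rw [col_eq_iff]
  constructor
  · refine fun h => ⟨fun b hb a ha hs => ?_, fun s hs => ?_⟩
    · rw [← cellRule_of_notMem hb ha hs]
      exact h b hb a ha
    · have hs' := (mem_vertices.mp hs).1
      rw [← cellRule_of_mem (D := D) (o := o) hs]
      exact h _ hs'.1 _ hs'.2
  · rintro ⟨h1, h2⟩ b hb a ha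
    by_cases hs : (b, a) ∈ vertices K c
    · rw [cellRule_of_mem hs]
      exact h2 _ hs
    · rw [cellRule_of_notMem hb ha hs o']
      exact h1 b hb a ha hs

end Deterministic

section Measurability

variable {Ω α : Type*} [MeasurableSpace Ω] [MeasurableSpace α] [Countable α]
  [MeasurableSingletonClass α]

theorem measurable_apply_of_countable {β γ : Type*} [MeasurableSpace β] [MeasurableSpace γ]
    [Countable β] [MeasurableSingletonClass β] {f : Ω → β → γ} {g : Ω → β}
    (hf : ∀ x, Measurable fun ω => f ω x) (hg : Measurable g) : Measurable fun ω => f ω (g ω) :=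
  (measurable_from_prod_countable_left (f := fun z : Ω × β => f z.1 z.2) hf).comp
    (measurable_id.prodMk hg)

theorem measurable_grid {z : α} {Φ : Ω → ℕ → ℕ → α → α → α × α}
    (hΦ : ∀ b a x y, Measurable fun ω => Φ ω b a x y) (b a : ℕ) :
    Measurable (fun ω => gridV z (Φ ω) b a) ∧ Measurable fun ω => gridH z (Φ ω) b a := by
  have hΦ' : ∀ (b a) (V H : Ω → α), Measurable V → Measurable H →
      Measurable fun ω => Φ ω b a (V ω) (H ω) := fun b a V H hV hH =>
    measurable_apply_of_countable (f := fun ω (x : α × α) => Φ ω b a x.1 x.2)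
      (fun x => hΦ b a x.1 x.2) (hV.prodMk hH)
  have hrow : ∀ b, (∀ a, Measurable fun ω => gridV z (Φ ω) b a) →
      ∀ a, Measurable fun ω => gridH z (Φ ω) b a := by
    intro b hV a
    induction a with
    | zero => exact measurable_const
    | succ a ih => exact (hΦ' b a _ _ (hV a) ih).snd
  have hcol : ∀ b a, Measurable fun ω => gridV z (Φ ω) b a := by
    intro b
    induction b with
    | zero => exact fun _ => measurable_const
    | succ b ih => exact fun a => (hΦ' b a _ _ (ih a) (hrow b ih a)).fst
  exact ⟨hcol b a, hrow b (hcol b) a⟩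

variable {c : Ω → ℕ → ℕ → Bool} {o : Ω → ℕ → ℕ → Finset ℤ → Finset ℤ → Finset ℤ × Finset ℤ}

theorem measurable_col (D : ℕ) (hc : ∀ b a, Measurable fun ω => c ω b a)
    (ho : ∀ b a x y, Measurable fun ω => o ω b a x y) (b a : ℕ) :
    Measurable (fun ω => colV D (c ω) (o ω) b a) ∧ Measurable fun ω => colH D (c ω) (o ω) b a := by
  refine measurable_grid (fun b a x y => ?_) b a
  have hcm : ∀ b a, MeasurableSet {ω | c ω b a = true} := fun b a =>
    hc b a (measurableSet_singleton true)
  have hM : MeasurableSet {ω | Meets (c ω) b a} := by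
    unfold Meets
    measurability
  exact Measurable.ite (hcm b a) measurable_const (Measurable.ite hM (ho b a x y) measurable_const)

theorem measurable_gridX {V : Ω → ℕ → ℕ → Finset ℤ} (hV : ∀ b a, Measurable fun ω => V ω b a)
    (D m n : ℕ) : Measurable fun ω => gridX D (V ω) m n :=
  Finset.measurable_sum _ fun _ _ => (measurable_of_countable (proj _)).comp (hV _ _)

end Measurability

section Law

variable {Ω₁ Ω₂ : Type*} [MeasurableSpace Ω₁] [MeasurableSpace Ω₂] {P₁ : Measure Ω₁}
  {P₂ : Measure Ω₂} {K : ℕ} {c : ℕ → ℕ → Bool}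
  {o₁ : Ω₁ → ℕ → ℕ → Finset ℤ → Finset ℤ → Finset ℤ × Finset ℤ}
  {o₂ : Ω₂ → ℕ → ℕ → Finset ℤ → Finset ℤ → Finset ℤ × Finset ℤ}

open Classical in
/-- By independence, the probability that the lines take given values is the product of the
probabilities of the outcomes at the vertices, provided that the values obey the deterministic local
rules elsewhere. -/
theorem measure_col_eq (D : ℕ) (w : Finset ℤ → Finset ℤ → Finset ℤ × Finset ℤ → ENNReal)
    (h₁ : ∀ (x y : ℕ × ℕ → Finset ℤ) (q : ℕ × ℕ → Finset ℤ × Finset ℤ),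
      P₁ {ω | ∀ s ∈ vertices K c, o₁ ω s.1 s.2 (x s) (y s) = q s} =
        ∏ s ∈ vertices K c, w (x s) (y s) (q s)) (q : ℕ × ℕ → Finset ℤ × Finset ℤ) :
    P₁ {ω | ∀ b < K, ∀ a < K,
        (colV D c (o₁ ω) (b + 1) a, colH D c (o₁ ω) b (a + 1)) = q (b, a)} =
      if ∀ b < K, ∀ a < K, (b, a) ∉ vertices K c →
        cellRule D c (fun _ _ _ _ => (∅, ∅)) b a (inputV q b a) (inputH q b a) = q (b, a)
      then ∏ s ∈ vertices K c, w (inputV q s.1 s.2) (inputH q s.1 s.2) (q s) else 0 := by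
  simp_rw [col_eq_iff_vertices (o := o₁ _) (fun _ _ _ _ => (∅, ∅))]
  split_ifs with hcond
  · rw [← h₁ (fun s => inputV q s.1 s.2) (fun s => inputH q s.1 s.2) q]
    congr 1
    ext ω
    exact and_iff_right hcond
  · convert measure_empty (μ := P₁)
    ext ω
    exact iff_of_false (fun hω => hcond hω.1) id

/-- The states that leave the cells of the square `[0, K)²`. -/
noncomputable def leaving (K D : ℕ) (c : ℕ → ℕ → Bool)
    (o : ℕ → ℕ → Finset ℤ → Finset ℤ → Finset ℤ × Finset ℤ) :
    Fin K × Fin K → Finset ℤ × Finset ℤ := fun s =>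
  (colV D c o (s.1 + 1) s.2, colH D c o s.1 (s.2 + 1))

theorem measurable_leaving (D : ℕ) (ho : ∀ b a x y, Measurable fun ω => o₁ ω b a x y) :
    Measurable fun ω => leaving K D c (o₁ ω) :=
  measurable_pi_lambda _ fun _ => Measurable.prodMk
    (measurable_col D (c := fun _ => c) (fun _ _ => measurable_const) ho _ _).1
    (measurable_col D (c := fun _ => c) (fun _ _ => measurable_const) ho _ _).2

/-- Every vertex is queried with only one pair of inputs. Hence, if the outcomes of different
vertices are independent, then the law of the lines depends only on the laws of the outcomes for
each fixed pair of inputs, and not on the joint law for different inputs. -/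
theorem measure_colV_eq (D : ℕ) (w : Finset ℤ → Finset ℤ → Finset ℤ × Finset ℤ → ENNReal)
    (hm₁ : ∀ b a x y, Measurable fun ω => o₁ ω b a x y)
    (hm₂ : ∀ b a x y, Measurable fun ω => o₂ ω b a x y)
    (h₁ : ∀ (x y : ℕ × ℕ → Finset ℤ) (q : ℕ × ℕ → Finset ℤ × Finset ℤ),
      P₁ {ω | ∀ s ∈ vertices K c, o₁ ω s.1 s.2 (x s) (y s) = q s} =
        ∏ s ∈ vertices K c, w (x s) (y s) (q s))
    (h₂ : ∀ (x y : ℕ × ℕ → Finset ℤ) (q : ℕ × ℕ → Finset ℤ × Finset ℤ),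
      P₂ {ω | ∀ s ∈ vertices K c, o₂ ω s.1 s.2 (x s) (y s) = q s} =
        ∏ s ∈ vertices K c, w (x s) (y s) (q s))
    {S : Set (ℕ → ℕ → Finset ℤ)}
    (hS : ∀ V V', (∀ b ≤ K, ∀ a < K, V b a = V' b a) → (V ∈ S ↔ V' ∈ S)) :
    P₁ {ω | colV D c (o₁ ω) ∈ S} = P₂ {ω | colV D c (o₂ ω) ∈ S} := by
  classical
  let ext : (Fin K × Fin K → Finset ℤ × Finset ℤ) → ℕ × ℕ → Finset ℤ × Finset ℤ := fun q s =>
    if h : s.1 < K ∧ s.2 < K then q (⟨s.1, h.1⟩, ⟨s.2, h.2⟩) else (∅, ∅)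
  have hext : ∀ q b a (hb : b < K) (ha : a < K), ext q (b, a) = q (⟨b, hb⟩, ⟨a, ha⟩) :=
    fun q b a hb ha => dif_pos ⟨hb, ha⟩
  have hiff : ∀ o q, leaving K D c o = q ↔
      ∀ b < K, ∀ a < K, (colV D c o (b + 1) a, colH D c o b (a + 1)) = ext q (b, a) := by
    intro o q
    constructor
    · rintro rfl b hb a ha
      rw [hext _ _ _ hb ha]
      rfl
    · intro h
      ext1 ⟨b, a⟩
      rw [← hext q b a b.2 a.2, ← h b b.2 a a.2]
      rfl
  have hlaw : P₁.map (fun ω => leaving K D c (o₁ ω)) = P₂.map (fun ω => leaving K D c (o₂ ω)) := by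
    refine Measure.ext_of_singleton fun q => ?_
    rw [Measure.map_apply (measurable_leaving D hm₁) (measurableSet_singleton q),
      Measure.map_apply (measurable_leaving D hm₂) (measurableSet_singleton q)]
    simp only [Set.preimage, Set.mem_singleton_iff, hiff]
    exact (measure_col_eq D w h₁ _).trans (measure_col_eq D w h₂ _).symm
  have hpre : ∀ o, colV D c o ∈ S ↔ leaving K D c o ∈ {q | inputV (ext q) ∈ S} := fun o =>
    hS _ _ (colV_eq_inputV ((hiff o _).mp rfl)).1
  simp_rw [hpre]
  have := congrArg (fun μ => μ {q | inputV (ext q) ∈ S}) hlaw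
  rw [Measure.map_apply (measurable_leaving D hm₁) (Set.to_countable _).measurableSet,
    Measure.map_apply (measurable_leaving D hm₂) (Set.to_countable _).measurableSet] at this
  exact this

end Law

/-! ### The law of the occupied cells -/

/-- The law of the presence of nucleations in a cell of side length `1 / D`. -/
noncomputable def cellMeasure (D : ℕ) : Measure Bool :=
  (poissonMeasure (ENNReal.ofReal (1 / D) * ENNReal.ofReal (1 / D)).toNNReal).map
    fun n => decide (n ≠ 0)

instance (D : ℕ) : IsProbabilityMeasure (cellMeasure D) :=
  Measure.isProbabilityMeasure_map (measurable_of_countable _).aemeasurable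

section Occupied

variable {Ω : Type*} [MeasurableSpace Ω] {P : Measure Ω} {p : ℕ → Ω → ℝ × ℝ}

theorem occupied_eq_decide_encard (D b a : ℕ) (p : ℕ → ℝ × ℝ) :
    occupied D p b a =
      decide ({i | p i ∈ {z | row D z = b ∧ column D z = a}}.encard ≠ 0) := by
  rw [occupied, decide_eq_decide, Set.encard_ne_zero]
  rfl

theorem measurableSet_cell (D b a : ℕ) : MeasurableSet {z | row D z = b ∧ column D z = a} :=
  (measurable_row D (measurableSet_singleton b)).inter
    (measurable_column D (measurableSet_singleton a))

theorem measurable_occupied (hp : ∀ i, Measurable (p i)) (D b a : ℕ) :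
    Measurable fun ω => occupied D (fun i => p i ω) b a := by
  refine measurable_to_bool ?_
  have : (fun ω => occupied D (fun i => p i ω) b a) ⁻¹' {true} =
      ⋃ i, p i ⁻¹' {z | row D z = b ∧ column D z = a} := by
    ext ω
    simp [occupied_eq_true]
  rw [this]
  exact MeasurableSet.iUnion fun i => hp i (measurableSet_cell D b a)

theorem map_occupied (h : IsPoissonProcess P intensity p) {D : ℕ} (hD : 0 < D) :
    P.map (fun ω (s : ℕ × ℕ) => occupied D (fun i => p i ω) s.1 s.2) =
      Measure.infinitePi fun _ => cellMeasure D := by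
  have hindep : iIndepFun (fun (s : ℕ × ℕ) ω => occupied D (fun i => p i ω) s.1 s.2) P := by
    rw [iIndepFun_iff_finset]
    intro T
    have h1 := h.indep T.card (fun q => {z | row D z = (T.equivFin.symm q).1.1 ∧
      column D z = (T.equivFin.symm q).1.2}) (fun q => measurableSet_cell D _ _) (by
        intro q q' hq
        refine Set.disjoint_left.mpr fun z hz hz' => hq ?_
        refine T.equivFin.symm.injective (Subtype.ext (Prod.ext ?_ ?_))
        · exact hz.1.symm.trans hz'.1
        · exact hz.2.symm.trans hz'.2)
    have h2 := (h1.comp (fun _ n => decide (n ≠ 0)) fun _ => Measurable.of_discrete).precomp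
      T.equivFin.injective
    convert h2 using 2 with s
    ext ω
    simp only [Function.comp, Equiv.symm_apply_apply, Finset.restrict]
    rw [occupied_eq_decide_encard]
  rw [hindep.map_fun_eq_infinitePi_map fun s => measurable_occupied h.measurable D _ _]
  congr 1
  ext1 s
  have hcell := h.hasLaw _ (measurableSet_cell D s.1 s.2)
    (by
      rw [intensity_cell hD]
      exact ENNReal.mul_ne_top ENNReal.ofReal_ne_top ENNReal.ofReal_ne_top)
  rw [intensity_cell hD] at hcell
  have hmap : (fun ω => occupied D (fun i => p i ω) s.1 s.2) = (fun n : ℕ∞ => decide (n ≠ 0)) ∘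
      fun ω => {i | p i ω ∈ {z | row D z = s.1 ∧ column D z = s.2}}.encard := by
    ext ω
    exact occupied_eq_decide_encard _ _ _ _
  rw [hmap, ← AEMeasurable.map_map_of_aemeasurable Measurable.of_discrete.aemeasurable
    hcell.aemeasurable, hcell.map_eq, Measure.map_map Measurable.of_discrete
    (measurable_of_countable _)]
  rw [cellMeasure]
  congr 1
  ext n
  simp

end Occupied

/-! ### The grid model with independent coins -/

theorem infinitePi_prod_map_sumElim {ι κ X : Type*} [MeasurableSpace X] (μ : ι → Measure X)
    (ν : κ → Measure X) [∀ i, IsProbabilityMeasure (μ i)] [∀ i, IsProbabilityMeasure (ν i)]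
    [∀ i, IsProbabilityMeasure (Sum.elim μ ν i)] :
    ((Measure.infinitePi μ).prod (Measure.infinitePi ν)).map (fun z i => Sum.elim z.1 z.2 i) =
      Measure.infinitePi (Sum.elim μ ν) := by
  refine Measure.eq_infinitePi _ fun s t ht => ?_
  have hpre : (fun z : (ι → X) × (κ → X) => fun i => Sum.elim z.1 z.2 i) ⁻¹' (Set.pi s t) =
      (Set.pi s.toLeft fun i => t (Sum.inl i)) ×ˢ (Set.pi s.toRight fun i => t (Sum.inr i)) := by
    ext z
    simp [Set.mem_pi]
  rw [Measure.map_apply ?_ (MeasurableSet.pi s.countable_toSet fun i _ => ht i), hpre,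
    Measure.prod_prod, Measure.infinitePi_pi _ fun i _ => ht _,
    Measure.infinitePi_pi _ fun i _ => ht _, Finset.prod_sum_eq_prod_toLeft_mul_prod_toRight]
  · rfl
  · refine measurable_pi_lambda _ fun i => ?_
    cases i with
    | inl i => exact (measurable_pi_apply i).comp measurable_fst
    | inr i => exact (measurable_pi_apply i).comp measurable_snd

/-- The law of the occupation of a cell (on the left) or of a coin (on the right). -/
noncomputable def siteMeasure (D : ℕ) (t : unitInterval) {ι κ : Type*} : ι ⊕ κ → Measure Bool :=
  Sum.elim (fun _ => cellMeasure D) fun _ => coinMeasure t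

instance (D : ℕ) (t : unitInterval) {ι κ : Type*} (i : ι ⊕ κ) :
    IsProbabilityMeasure (siteMeasure D t i) := by
  cases i with
  | inl _ => exact inferInstanceAs (IsProbabilityMeasure (cellMeasure D))
  | inr _ => exact inferInstanceAs (IsProbabilityMeasure (coinMeasure t))

/-- The sample space of the grid model: the presence of nucleations in the cells, and the coins
of the cells. -/
abbrev Sample : Type := (ℕ × ℕ) ⊕ (ℕ × ℕ) → Bool

/-- The law of the grid model of mesh `1 / D`: all cells and all coins are independent. -/
noncomputable def sampleMeasure (D : ℕ) (t : unitInterval) : Measure Sample :=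
  Measure.infinitePi (siteMeasure D t)

/-- The colors entering the cells from the bottom, in the grid model with independent coins. -/
noncomputable def sampleV (D : ℕ) (w : Sample) : ℕ → ℕ → Finset ℤ :=
  colV D (fun b a => w (Sum.inl (b, a))) fun b a => outcome (w (Sum.inr (b, a)))

theorem measurable_outcome (x y : Finset ℤ) : Measurable fun coin => outcome coin x y :=
  measurable_of_countable _

theorem measurable_sampleV (D b a : ℕ) : Measurable fun w => sampleV D w b a :=
  (measurable_col D (c := fun (w : Sample) b a => w (Sum.inl (b, a)))
    (o := fun w b a => outcome (w (Sum.inr (b, a)))) (fun _ _ => measurable_pi_apply _)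
    (fun _ _ x y => (measurable_outcome x y).comp (measurable_pi_apply _)) b a).1

/-- The configurations in which the numbers of lines at the top sides of the squares `[m, n]²`,
where `(m, n) ∈ R`, belong to given sets. -/
def topEvent (D : ℕ) (R : Finset (ℕ × ℕ)) (B : ℕ × ℕ → Set ℝ) : Set (ℕ → ℕ → Finset ℤ) :=
  {V | ∀ r ∈ R, (gridX D V r.1 r.2 : ℝ) ∈ B r}

theorem measurableSet_topEvent {Ω : Type*} [MeasurableSpace Ω] {V : Ω → ℕ → ℕ → Finset ℤ}
    (hV : ∀ b a, Measurable fun ω => V ω b a) (D : ℕ) (R : Finset (ℕ × ℕ))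
    (B : ℕ × ℕ → Set ℝ) : MeasurableSet {ω | V ω ∈ topEvent D R B} := by
  have : {ω | V ω ∈ topEvent D R B} =
      ⋂ r ∈ R, (fun ω => gridX D (V ω) r.1 r.2) ⁻¹' {n : ℕ | (n : ℝ) ∈ B r} := by
    ext ω
    simp [topEvent]
  rw [this]
  exact R.measurableSet_biInter fun r _ => measurable_gridX hV D _ _ MeasurableSet.of_discrete

theorem topEvent_congr {D N : ℕ} {R : Finset (ℕ × ℕ)} (hR : ∀ r ∈ R, r.2 ≤ N)
    (B : ℕ × ℕ → Set ℝ) {V V' : ℕ → ℕ → Finset ℤ}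
    (h : ∀ b ≤ N * D, ∀ a < N * D, V b a = V' b a) :
    V ∈ topEvent D R B ↔ V' ∈ topEvent D R B := by
  have key : ∀ r ∈ R, gridX D V r.1 r.2 = gridX D V' r.1 r.2 := by
    intro r hr
    have hK := Nat.mul_le_mul_right D (hR r hr)
    refine Finset.sum_congr rfl fun a ha => ?_
    rw [h _ hK a ((Finset.mem_Ico.mp ha).2.trans_le hK)]
  exact forall₂_congr fun r hr => by rw [key r hr]

/-! ### Comparison of the colored model with the grid model -/

/-- What the grid model needs to know about the nucleations: the index of the nucleation in each
column and in each row, and the set of the occupied cells. -/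
noncomputable def gridData (N D : ℕ) (p : ℕ → ℝ × ℝ) : (ℕ → ℕ) × (ℕ → ℕ) × (ℕ → ℕ → Bool) :=
  (colIdx N D p, rowIdx N D p, occupied D p)

/-- The colors entering the cells from the bottom, given the data of the nucleations and the
outcomes. -/
noncomputable def dataV (D : ℕ) (d : (ℕ → ℕ) × (ℕ → ℕ) × (ℕ → ℕ → Bool))
    (ξ : ℕ × ℕ → Finset ℤ → Finset ℤ → Finset ℤ × Finset ℤ) : ℕ → ℕ → Finset ℤ :=
  colV D d.2.2 fun b a => ξ (d.1 a, d.2.1 b)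

theorem measurable_sInf_setOf {Ω : Type*} [MeasurableSpace Ω] {A : ℕ → Set Ω}
    (hA : ∀ i, MeasurableSet (A i)) : Measurable fun ω => sInf {i | ω ∈ A i} := by
  refine measurable_of_Ici fun n => ?_
  have : (fun ω => sInf {i | ω ∈ A i}) ⁻¹' Set.Ici n =
      ((⋃ i, A i) ∩ ⋂ i ∈ Finset.range n, (A i)ᶜ) ∪ ((⋃ i, A i)ᶜ ∩ {_ω | n = 0}) := by
    ext ω
    simp only [Set.mem_preimage, Set.mem_Ici, Set.mem_union, Set.mem_inter_iff, Set.mem_iUnion,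
      Set.mem_iInter, Set.mem_compl_iff, Finset.mem_range, Set.mem_ofPred_eq]
    by_cases hne : ∃ i, ω ∈ A i
    · simp only [hne, true_and, not_true_eq_false, false_and, or_false]
      constructor
      · exact fun h i hi hiA =>
          absurd (h.trans (Nat.sInf_le (s := {i | ω ∈ A i}) hiA)) (not_le.mpr hi)
      · intro h
        by_contra hlt
        exact h _ (not_le.mp hlt) (Nat.sInf_mem (s := {i | ω ∈ A i}) hne)
    · have hempty : {i | ω ∈ A i} = ∅ := by
        ext i
        exact iff_of_false (fun h => hne ⟨i, h⟩) id
      simp [hempty, hne]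
  rw [this]
  exact ((MeasurableSet.iUnion hA).inter
    (Finset.measurableSet_biInter _ fun i _ => (hA i).compl)).union
      ((MeasurableSet.iUnion hA).compl.inter (MeasurableSet.const _))

theorem measurable_gridData (N D : ℕ) : Measurable (gridData N D) := by
  have hc : ∀ i, Measurable fun p : ℕ → ℝ × ℝ => column D (p i) := fun i =>
    (measurable_column D).comp (measurable_pi_apply i)
  have hr : ∀ i, Measurable fun p : ℕ → ℝ × ℝ => row D (p i) := fun i =>
    (measurable_row D).comp (measurable_pi_apply i)
  have hsq : ∀ i, MeasurableSet {p : ℕ → ℝ × ℝ | p i ∈ square N D} := fun i =>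
    (hc i measurableSet_Iio).inter (hr i measurableSet_Iio)
  refine Measurable.prodMk (measurable_pi_lambda _ fun a => ?_)
    (Measurable.prodMk (measurable_pi_lambda _ fun b => ?_) (measurable_pi_lambda _ fun b =>
      measurable_pi_lambda _ fun a => measurable_occupied (fun i => measurable_pi_apply i) D b a))
  · exact measurable_sInf_setOf fun i => (hsq i).inter (hc i (measurableSet_singleton a))
  · exact measurable_sInf_setOf fun i => (hsq i).inter (hr i (measurableSet_singleton b))

theorem measurable_dataV (D b a : ℕ) : Measurable fun z : ((ℕ → ℕ) × (ℕ → ℕ) × (ℕ → ℕ → Bool)) ×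
    (ℕ × ℕ → Finset ℤ → Finset ℤ → Finset ℤ × Finset ℤ) => dataV D z.1 z.2 b a := by
  refine (measurable_col D (fun b a => ?_) (fun b a x y => ?_) b a).1
  · exact (measurable_pi_apply a).comp ((measurable_pi_apply b).comp measurable_fst.snd.snd)
  · refine measurable_apply_of_countable
      (f := fun (z : ((ℕ → ℕ) × (ℕ → ℕ) × (ℕ → ℕ → Bool)) ×
        (ℕ × ℕ → Finset ℤ → Finset ℤ → Finset ℤ × Finset ℤ)) v => z.2 v x y)
      (g := fun z => (z.1.1 a, z.1.2.1 b)) (fun v => ?_) ?_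
    · exact (measurable_pi_apply y).comp
        ((measurable_pi_apply x).comp ((measurable_pi_apply v).comp measurable_snd))
    · exact ((measurable_pi_apply a).comp measurable_fst.fst).prodMk
        ((measurable_pi_apply b).comp measurable_fst.snd.fst)

theorem lintegral_le_add_of_eqOn {Ω : Type*} [MeasurableSpace Ω] {P : Measure Ω}
    {f g : Ω → ENNReal} {A : Set Ω} (hA : MeasurableSet A)
    (hf : ∀ ω, f ω ≤ 1) (h : ∀ ω ∈ A, f ω = g ω) : ∫⁻ ω, f ω ∂P ≤ ∫⁻ ω, g ω ∂P + P Aᶜ := by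
  rw [← lintegral_indicator_one hA.compl,
    ← lintegral_add_right _ (measurable_one.indicator hA.compl)]
  refine lintegral_mono fun ω => ?_
  by_cases hω : ω ∈ A
  · rw [h ω hω]
    exact le_self_add
  · rw [Set.indicator_of_mem hω]
    exact (hf ω).trans le_add_self

section Comparison

variable {Ω : Type*} [MeasurableSpace Ω] {P : Measure Ω} [IsProbabilityMeasure P]
  {t : unitInterval} {p : ℕ → Ω → ℝ × ℝ}
  {ξ : ℕ × ℕ → Ω → Finset ℤ → Finset ℤ → Finset ℤ × Finset ℤ}

theorem measurable_eval_outcome {v : ℕ × ℕ} (hξ : Measurable (ξ v)) (x y : Finset ℤ) :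
    Measurable fun ω => ξ v ω x y :=
  (measurable_pi_apply y).comp ((measurable_pi_apply x).comp hξ)

theorem IsStepColored.ae_exists_outcome (h : IsStepColored P t p ξ) :
    ∀ᵐ ω ∂P, ∀ v x y, ∃ coin, ξ v ω x y = outcome coin x y :=
  ae_all_iff.mpr fun v => ae_all_iff.mpr fun x => ae_all_iff.mpr fun y =>
    (TPNG.ae_exists_outcome (measurable_eval_outcome (h.measurable v) x y)
      fun k l => h.law v x y k l).1

theorem Separated.index_injOn {p : ℕ → ℝ × ℝ} {N D : ℕ} (h : Separated p N D) :
    Set.InjOn (fun s : ℕ × ℕ => (colIdx N D p s.2, rowIdx N D p s.1))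
      (vertices (N * D) (occupied D p)) := by
  have key : ∀ s ∈ vertices (N * D) (occupied D p),
      column D (p (colIdx N D p s.2)) = s.2 ∧ row D (p (rowIdx N D p s.1)) = s.1 := by
    rintro ⟨b, a⟩ hs
    obtain ⟨⟨hb, ha⟩, -, ⟨b', hb', h1⟩, a', ha', h2⟩ := mem_vertices.mp hs
    obtain ⟨i, rfl, rfl⟩ := occupied_eq_true.mp h1
    obtain ⟨j, rfl, rfl⟩ := occupied_eq_true.mp h2
    dsimp only
    rw [h.colIdx_column ⟨ha, hb'.trans hb⟩, h.rowIdx_row ⟨ha'.trans ha, hb⟩]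
    exact ⟨rfl, rfl⟩
  intro s hs s' hs' hss
  obtain ⟨h1, h2⟩ := Prod.ext_iff.mp hss
  dsimp only at h1 h2
  refine Prod.ext ?_ ?_
  · rw [← (key s hs).2, ← (key s' hs').2, h2]
  · rw [← (key s hs).1, ← (key s' hs').1, h1]

/-- For given nucleations, the lines of the colored model have the law of the grid model with
independent coins. -/
theorem IsStepColored.measure_dataV_eq (h : IsStepColored P t p ξ) {p₀ : ℕ → ℝ × ℝ} {N D : ℕ}
    (h₀ : Separated p₀ N D) {S : Set (ℕ → ℕ → Finset ℤ)}
    (hS : ∀ V V', (∀ b ≤ N * D, ∀ a < N * D, V b a = V' b a) → (V ∈ S ↔ V' ∈ S)) :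
    P {ω | dataV D (gridData N D p₀) (fun v => ξ v ω) ∈ S} =
      Measure.infinitePi (fun _ : ℕ × ℕ => coinMeasure t)
        {β | colV D (occupied D p₀) (fun b a => outcome (β (b, a))) ∈ S} := by
  refine measure_colV_eq (K := N * D) D (fun x y q => coinMeasure t {coin | outcome coin x y = q})
    (fun b a x y => measurable_eval_outcome (h.measurable _) x y)
    (fun b a x y => (measurable_outcome x y).comp (measurable_pi_apply _))
    (fun x y q => ?_) (fun x y q => ?_) hS
  · have hind := h.indep.precomp (g := fun s : vertices (N * D) (occupied D p₀) =>
      (colIdx N D p₀ s.1.2, rowIdx N D p₀ s.1.1)) (fun s s' hss =>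
        Subtype.ext (h₀.index_injOn s.2 s'.2 hss))
    have hm : ∀ s : ℕ × ℕ, Measurable fun f : Finset ℤ → Finset ℤ → Finset ℤ × Finset ℤ =>
        f (x s) (y s) := fun s => (measurable_pi_apply (y s)).comp (measurable_pi_apply (x s))
    have hprod := hind.measure_inter_preimage_eq_mul Finset.univ
      (sets := fun s => {f | f (x s.1) (y s.1) = q s.1}) fun s _ =>
        hm s.1 (measurableSet_singleton (q s.1))
    have hset : {ω | ∀ s ∈ vertices (N * D) (occupied D p₀),
        ξ (colIdx N D p₀ s.2, rowIdx N D p₀ s.1) ω (x s) (y s) = q s} =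
        ⋂ s ∈ (Finset.univ : Finset (vertices (N * D) (occupied D p₀))),
          ξ (colIdx N D p₀ s.1.2, rowIdx N D p₀ s.1.1) ⁻¹' {f | f (x s.1) (y s.1) = q s.1} := by
      ext ω
      simp
    refine ((congrArg P hset).trans hprod).trans ?_
    refine Eq.trans ?_ (Finset.prod_coe_sort (vertices (N * D) (occupied D p₀)) fun s =>
      coinMeasure t {coin | outcome coin (x s) (y s) = q s})
    refine Finset.prod_congr rfl fun s _ => ?_
    exact (TPNG.ae_exists_outcome (measurable_eval_outcome (h.measurable _) (x s.1) (y s.1))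
      fun k l => h.law _ _ _ k l).2 (q s.1)
  · rw [← Measure.infinitePi_pi (μ := fun _ : ℕ × ℕ => coinMeasure t)
      (t := fun s => {coin | outcome coin (x s) (y s) = q s}) fun _ _ => .of_discrete]
    rfl

/-- Up to the probability that the grid does not separate the nucleations, the law of the numbers of
lines is that of the grid model with independent coins. -/
theorem IsStepColored.measure_close (h : IsStepColored P t p ξ) {N D : ℕ} (hD : 0 < D)
    {R : Finset (ℕ × ℕ)} (hR : ∀ r ∈ R, r.2 ≤ N) (B : ℕ × ℕ → Set ℝ) :
    let A := {ω | ∀ r ∈ R, randX p ξ r.1 r.2 ω ∈ B r}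
    let W := sampleMeasure D t {w | sampleV D w ∈ topEvent D R B}
    let e := P {ω | ¬ Separated (fun i => p i ω) N D}
    P A ≤ W + 2 * e ∧ W ≤ P A + 2 * e := by
  intro A W e
  set p' : Ω → ℕ → ℝ × ℝ := fun ω i => p i ω with hp'
  set ξ' : Ω → ℕ × ℕ → Finset ℤ → Finset ℤ → Finset ℤ × Finset ℤ := fun ω v => ξ v ω with hξ'
  have hpm : Measurable p' := measurable_pi_lambda _ h.poisson.measurable
  have hξm : Measurable ξ' := measurable_pi_lambda _ h.measurable
  have hdm : Measurable fun ω => gridData N D (p' ω) := (measurable_gridData N D).comp hpm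
  set S := topEvent D R B with hS
  have hScongr : ∀ V V', (∀ b ≤ N * D, ∀ a < N * D, V b a = V' b a) → (V ∈ S ↔ V' ∈ S) :=
    fun V V' hV => topEvent_congr hR B hV
  set f : Ω → ENNReal := fun ω => P {ω' | dataV D (gridData N D (p' ω)) (ξ' ω') ∈ S} with hf
  set g : Ω → ENNReal := fun ω => Measure.infinitePi (fun _ : ℕ × ℕ => coinMeasure t)
    {β | colV D (occupied D (p' ω)) (fun b a => outcome (β (b, a))) ∈ S} with hg
  have hsep : MeasurableSet {ω | Separated (p' ω) N D} :=
    measurableSet_separated h.poisson.measurable N D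
  -- the lines are read off from the grid, except on an event of small probability
  set A' := {ω | dataV D (gridData N D (p' ω)) (ξ' ω) ∈ S} with hA'
  have hAA' : ∀ᵐ ω ∂P, Separated (p' ω) N D → (ω ∈ A ↔ ω ∈ A') := by
    filter_upwards [h.ae_exists_outcome] with ω hω hs
    refine forall₂_congr fun r hr => ?_
    have := hs.X_eq_gridX hD hω (m := r.1) (hR r hr)
    unfold randX
    rw [this]
    rfl
  have h1 : P A ≤ P A' + e := by
    refine (measure_mono_ae ?_).trans (measure_union_le A' {ω | ¬ Separated (p' ω) N D})
    filter_upwards [hAA'] with ω hω hA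
    by_cases hs : Separated (p' ω) N D
    · exact Or.inl ((hω hs).mp hA)
    · exact Or.inr hs
  have h2 : P A' ≤ P A + e := by
    refine (measure_mono_ae ?_).trans (measure_union_le A {ω | ¬ Separated (p' ω) N D})
    filter_upwards [hAA'] with ω hω hA
    by_cases hs : Separated (p' ω) N D
    · exact Or.inl ((hω hs).mpr hA)
    · exact Or.inr hs
  -- disintegration with respect to the nucleations
  have hPf : P A' = ∫⁻ ω, f ω ∂P := by
    have hind := (h.indep_nucleations.comp (measurable_gridData N D) measurable_id)
    have hlaw := (indepFun_iff_map_prod_eq_prod_map_map hdm.aemeasurable hξm.aemeasurable).mp hind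
    have hE := measurableSet_topEvent (measurable_dataV D) D R B
    have hmap := Measure.map_apply (μ := P) (hdm.prodMk hξm) hE
    have hlaw' : P.map (fun ω => (gridData N D (p' ω), ξ' ω)) =
        (P.map fun ω => gridData N D (p' ω)).prod (P.map ξ') := hlaw
    refine hmap.symm.trans ?_
    rw [hlaw', Measure.prod_apply hE, lintegral_map (measurable_measure_prodMk_left hE) hdm]
    refine lintegral_congr fun ω => ?_
    exact Measure.map_apply hξm (measurable_prodMk_left hE)
  have hWg : W = ∫⁻ ω, g ω ∂P := by
    have hom : Measurable fun ω (s : ℕ × ℕ) => occupied D (p' ω) s.1 s.2 :=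
      measurable_pi_lambda _ fun s => measurable_occupied h.poisson.measurable D _ _
    have hE := measurableSet_topEvent (measurable_sampleV D) D R B
    have hm : Measurable fun (z : (ℕ × ℕ → Bool) × (ℕ × ℕ → Bool)) i => Sum.elim z.1 z.2 i := by
      refine measurable_pi_lambda _ fun i => ?_
      cases i with
      | inl i => exact (measurable_pi_apply i).comp measurable_fst
      | inr i => exact (measurable_pi_apply i).comp measurable_snd
    have hprod : sampleMeasure D t =
        ((P.map fun ω (s : ℕ × ℕ) => occupied D (p' ω) s.1 s.2).prod
          (Measure.infinitePi fun _ : ℕ × ℕ => coinMeasure t)).map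
            (fun z i => Sum.elim z.1 z.2 i) := by
      rw [map_occupied h.poisson hD]
      have : ∀ i, IsProbabilityMeasure (Sum.elim (fun _ : ℕ × ℕ => cellMeasure D)
        (fun _ : ℕ × ℕ => coinMeasure t) i) := fun i =>
          inferInstanceAs (IsProbabilityMeasure (siteMeasure D t i))
      exact (infinitePi_prod_map_sumElim _ _).symm
    change sampleMeasure D t _ = _
    rw [hprod, Measure.map_apply hm hE, Measure.prod_apply (hm hE),
      lintegral_map (measurable_measure_prodMk_left (hm hE)) hom]
    rfl
  have hfg : ∀ ω ∈ {ω | Separated (p' ω) N D}, f ω = g ω := fun ω hω =>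
    h.measure_dataV_eq hω hScongr
  have h3 : P A' ≤ W + e := by
    rw [hPf, hWg]
    exact lintegral_le_add_of_eqOn hsep (fun ω => prob_le_one) hfg
  have h4 : W ≤ P A' + e := by
    rw [hPf, hWg]
    exact lintegral_le_add_of_eqOn hsep (fun ω => prob_le_one) fun ω hω => (hfg ω hω).symm
  rw [two_mul, ← add_assoc, ← add_assoc]
  exact ⟨h1.trans (by gcongr), h4.trans (by gcongr)⟩

theorem tendsto_measure_not_separated (h : IsPoissonProcess P intensity p) (N : ℕ) :
    Filter.Tendsto (fun M : ℕ => P {ω | ¬ Separated (fun i => p i ω) N (M + 1)}) Filter.atTop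
      (nhds 0) := by
  have hlim : Filter.Tendsto (fun M : ℕ => ENNReal.ofReal (2 * N ^ 3 / (M + 1 : ℕ)))
      Filter.atTop (nhds 0) := by
    rw [← ENNReal.ofReal_zero]
    exact ENNReal.tendsto_ofReal ((Filter.tendsto_add_atTop_iff_nat 1).mpr
      (tendsto_const_div_atTop_nhds_zero_nat (2 * (N : ℝ) ^ 3)))
  exact tendsto_of_tendsto_of_tendsto_of_le_of_le tendsto_const_nhds hlim (fun _ => zero_le)
    fun M => measure_not_separated_le h N M.succ_pos

/-- The law of the numbers of lines is the limit of the laws for the grid models. -/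
theorem IsStepColored.tendsto_sampleMeasure (h : IsStepColored P t p ξ) (R : Finset (ℕ × ℕ))
    (B : ℕ × ℕ → Set ℝ) :
    Filter.Tendsto (fun M : ℕ => sampleMeasure (M + 1) t
        {w | sampleV (M + 1) w ∈ topEvent (M + 1) R B}) Filter.atTop
      (nhds (P {ω | ∀ r ∈ R, randX p ξ r.1 r.2 ω ∈ B r})) := by
  have hclose := fun M : ℕ => h.measure_close M.succ_pos (R := R) (N := R.sup Prod.snd)
    (fun r hr => Finset.le_sup (f := Prod.snd) hr) B
  have he : Filter.Tendsto (fun M : ℕ => 2 * P {ω | ¬ Separated (fun i => p i ω) (R.sup Prod.snd)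
      (M + 1)}) Filter.atTop (nhds 0) := by
    have := ENNReal.Tendsto.const_mul (a := 2) (tendsto_measure_not_separated h.poisson
      (R.sup Prod.snd)) (Or.inr (by simp))
    rwa [mul_zero] at this
  refine tendsto_of_tendsto_of_tendsto_of_le_of_le ?_ ?_
    (fun M => tsub_le_iff_right.mpr (hclose M).1) (fun M => (hclose M).2)
  · have := ENNReal.Tendsto.sub
      (tendsto_const_nhds (x := P {ω | ∀ r ∈ R, randX p ξ r.1 r.2 ω ∈ B r})
      (f := Filter.atTop)) he (Or.inl (measure_ne_top _ _))
    rwa [tsub_zero] at this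
  · have := (tendsto_const_nhds (x := P {ω | ∀ r ∈ R, randX p ξ r.1 r.2 ω ∈ B r})
      (f := Filter.atTop)).add he
    rwa [add_zero] at this

/-- Almost surely, some grid separates the nucleations. -/
theorem ae_exists_separated (h : IsPoissonProcess P intensity p) (N : ℕ) :
    ∀ᵐ ω ∂P, ∃ M, Separated (fun i => p i ω) N (M + 1) := by
  rw [ae_iff]
  refine le_antisymm (ge_of_tendsto' (tendsto_measure_not_separated h N) fun M =>
    measure_mono fun ω hω hs => hω ⟨M, hs⟩) zero_le

/-- On the event that a given grid separates the nucleations, the number of lines is a measurable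
function of the data; countably many of these events cover almost all of the sample space. -/
theorem IsStepColored.aemeasurable_randX (h : IsStepColored P t p ξ) (m n : ℕ) :
    AEMeasurable (randX p ξ m n) P := by
  have hsep : ∀ M : ℕ, MeasurableSet {ω | Separated (fun i => p i ω) n (M + 1)} := fun M =>
    measurableSet_separated h.poisson.measurable n (M + 1)
  have hP : P = P.restrict (⋃ M : ℕ, {ω | Separated (fun i => p i ω) n (M + 1)}) := by
    refine (Measure.restrict_eq_self_of_ae_mem ?_).symm
    filter_upwards [ae_exists_separated h.poisson n] with ω hω
    exact Set.mem_iUnion.mpr hω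
  rw [hP, aemeasurable_iUnion_iff]
  intro M
  have hm : Measurable fun ω => ((gridX (M + 1) (dataV (M + 1) (gridData n (M + 1) fun i => p i ω)
      fun v => ξ v ω) m n : ℕ) : ℝ) :=
    measurable_from_nat.comp (measurable_gridX (fun b a => (measurable_dataV (M + 1) b a).comp
      (((measurable_gridData n (M + 1)).comp (measurable_pi_lambda _ h.poisson.measurable)).prodMk
        (measurable_pi_lambda _ h.measurable))) (M + 1) m n)
  refine hm.aemeasurable.congr ?_
  filter_upwards [ae_restrict_mem (hsep M), ae_restrict_of_ae h.ae_exists_outcome] with ω hω hξ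
  exact (Separated.X_eq_gridX hω M.succ_pos hξ le_rfl).symm

end Comparison

/-! ### Stationarity and independence in the grid model -/

/-- The number of lines at the top side of the square of the first `K` rows and columns, in the
model with a single color. -/
def singleTop (K : ℕ) (w : Sample) : ℕ :=
  ∑ a ∈ Finset.range K,
    gridV 0 (fun b a => singleRule (w (Sum.inl (b, a))) (w (Sum.inr (b, a)))) K a

theorem singleTop_congr {K : ℕ} {w w' : Sample}
    (hl : ∀ b < K, ∀ a < K, w (Sum.inl (b, a)) = w' (Sum.inl (b, a)))
    (hr : ∀ b < K, ∀ a < K, w (Sum.inr (b, a)) = w' (Sum.inr (b, a))) :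
    singleTop K w = singleTop K w' := by
  refine Finset.sum_congr rfl fun a ha => ?_
  refine (grid_unique (K := K)
    (H := gridH 0 fun b a => singleRule (w (Sum.inl (b, a))) (w (Sum.inr (b, a))))
    (fun _ _ => gridV_zero _) (fun _ _ => gridH_zero _)
    fun b hb a ha => ?_).1 K le_rfl a (Finset.mem_range.mp ha)
  rw [← hl b hb a ha, ← hr b hb a ha]
  rfl

theorem measurable_singleTop (K : ℕ) : Measurable (singleTop K) := by
  refine Finset.measurable_sum _ fun a _ => ?_
  refine (measurable_grid (fun b a x y => ?_) K a).1
  have hz : Measurable fun w : Sample => (w (Sum.inl (b, a)), w (Sum.inr (b, a))) :=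
    (measurable_pi_apply _).prodMk (measurable_pi_apply _)
  exact (measurable_of_countable fun z : Bool × Bool => singleRule z.1 z.2 x y).comp hz

/-- The site at which a site lies after a diagonal shift by `s` rows and columns. -/
def shiftSite (s : ℕ) : (ℕ × ℕ) ⊕ (ℕ × ℕ) → (ℕ × ℕ) ⊕ (ℕ × ℕ) :=
  Sum.map (Prod.map (s + ·) (s + ·)) (Prod.map (s + ·) (s + ·))

theorem gridX_sampleV {D : ℕ} (hD : 0 < D) (w : Sample) (m k : ℕ) :
    gridX D (sampleV D w) m (m + k) = singleTop (k * D) fun i => w (shiftSite (m * D) i) := by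
  unfold gridX singleTop
  rw [Finset.sum_Ico_eq_sum_range, add_mul, Nat.add_sub_cancel_left]
  refine Finset.sum_congr rfl fun a _ => ?_
  exact (proj_col_eq_single (c := fun b a => w (Sum.inl (b, a))) hD
    (fun b a => w (Sum.inr (b, a))) m (k * D) a).1

theorem map_shift_sampleMeasure (D : ℕ) (t : unitInterval) (s : ℕ) :
    (sampleMeasure D t).map (fun w i => w (shiftSite s i)) = sampleMeasure D t := by
  have hinj : Function.Injective (shiftSite s) :=
    ((add_right_injective s).prodMap (add_right_injective s)).sumMap
      ((add_right_injective s).prodMap (add_right_injective s))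
  refine (Measure.map_infinitePi_infinitePi_of_inj hinj).trans ?_
  have : (fun i => siteMeasure D t (shiftSite s i)) = siteMeasure D t := by
    ext1 i
    cases i <;> rfl
  simp only [this]
  rfl

/-- The law of the numbers of lines at the top sides of the squares with a given lower left corner
on the diagonal does not depend on this corner. -/
theorem sampleMeasure_topEvent {D : ℕ} (hD : 0 < D) (t : unitInterval) (m : ℕ) (s : Finset ℕ)
    (T : ℕ → Set ℝ) :
    sampleMeasure D t {w | sampleV D w ∈
        topEvent D (s.image fun k => (m, m + k)) fun r => T (r.2 - r.1)} =
      sampleMeasure D t {w | ∀ k ∈ s, (singleTop (k * D) w : ℝ) ∈ T k} := by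
  have hset : {w | sampleV D w ∈ topEvent D (s.image fun k => (m, m + k)) fun r => T (r.2 - r.1)} =
      (fun w i => w (shiftSite (m * D) i)) ⁻¹'
        {w | ∀ k ∈ s, (singleTop (k * D) w : ℝ) ∈ T k} := by
    ext w
    simp only [topEvent, Set.mem_ofPred_eq, Set.mem_preimage, Finset.forall_mem_image,
      gridX_sampleV hD, Nat.add_sub_cancel_left]
  have hmeas : MeasurableSet {w : Sample | ∀ k ∈ s, (singleTop (k * D) w : ℝ) ∈ T k} := by
    have : {w : Sample | ∀ k ∈ s, (singleTop (k * D) w : ℝ) ∈ T k} =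
        ⋂ k ∈ s, singleTop (k * D) ⁻¹' {n : ℕ | (n : ℝ) ∈ T k} := by
      ext w
      simp
    rw [this]
    exact s.measurableSet_biInter fun k _ => measurable_singleTop _ .of_discrete
  rw [hset, ← Measure.map_apply (measurable_pi_lambda _ fun i => measurable_pi_apply _) hmeas,
    map_shift_sampleMeasure]

/-- The sites of a square of `K` rows and columns. -/
abbrev BlockSite (K : ℕ) : Type := (Fin K × Fin K) ⊕ (Fin K × Fin K)

/-- The sites of the square of the first `K` rows and columns, among all sites. -/
def blockSite (K : ℕ) : BlockSite K → (ℕ × ℕ) ⊕ (ℕ × ℕ) :=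
  Sum.map (Prod.map Fin.val Fin.val) (Prod.map Fin.val Fin.val)

theorem blockSite_injective (K : ℕ) : Function.Injective (blockSite K) :=
  (Fin.val_injective.prodMap Fin.val_injective).sumMap
    (Fin.val_injective.prodMap Fin.val_injective)

theorem singleTop_extend (K : ℕ) (w : Sample) :
    singleTop K (Function.extend (blockSite K) (fun i => w (blockSite K i)) fun _ => false) =
      singleTop K w :=
  singleTop_congr
    (fun b hb a ha => (blockSite_injective K).extend_apply _ _ (Sum.inl (⟨b, hb⟩, ⟨a, ha⟩)))
    (fun b hb a ha => (blockSite_injective K).extend_apply _ _ (Sum.inr (⟨b, hb⟩, ⟨a, ha⟩)))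

theorem shiftSite_blockSite_injective (K : ℕ) :
    Function.Injective fun z : ℕ × BlockSite K => shiftSite (z.1 * K) (blockSite K z.2) := by
  have key : ∀ (q q' : ℕ) (x x' : Fin K), q * K + x = q' * K + x' → q = q' ∧ x = x' := by
    intro q q' x x' h
    have hq : q = q' := by
      have h1 := Nat.div_eq_of_lt_le (k := q) (m := q * K + x) (n := K) (by omega)
        (by rw [add_mul]; omega)
      have h2 := Nat.div_eq_of_lt_le (k := q') (m := q' * K + x') (n := K) (by omega)
        (by rw [add_mul]; omega)
      rw [← h1, ← h2, h]
    subst hq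
    exact ⟨rfl, Fin.ext (by omega)⟩
  rintro ⟨q, i⟩ ⟨q', i'⟩ h
  rcases i with ⟨b, a⟩ | ⟨b, a⟩ <;> rcases i' with ⟨b', a'⟩ | ⟨b', a'⟩ <;>
    simp only [shiftSite, blockSite, Sum.map_inl, Sum.map_inr, Prod.map_apply, Sum.inl.injEq,
      Sum.inr.injEq, Prod.mk.injEq, reduceCtorEq] at h
  all_goals
    obtain ⟨rfl, rfl⟩ := key _ _ _ _ h.1
    obtain ⟨-, rfl⟩ := key _ _ _ _ h.2
    rfl

theorem map_blocks_sampleMeasure (D : ℕ) (t : unitInterval) (K : ℕ) :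
    (sampleMeasure D t).map (fun w q i => w (shiftSite (q * K) (blockSite K i))) =
      Measure.infinitePi fun _ : ℕ => Measure.infinitePi fun i : BlockSite K =>
        siteMeasure D t i := by
  have h1 := Measure.map_infinitePi_infinitePi_of_inj (P := siteMeasure D t)
    (shiftSite_blockSite_injective K)
  have h2 : (fun z : ℕ × BlockSite K => siteMeasure D t (shiftSite (z.1 * K) (blockSite K z.2))) =
      fun z => siteMeasure D t z.2 := by
    ext1 z
    rcases z with ⟨q, i | i⟩ <;> rfl
  simp only [h2] at h1
  have h3 := Measure.infinitePi_map_curry (ι := ℕ) (κ := BlockSite K) (X := Bool)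
    fun _ i => siteMeasure D t i
  have hm : Measurable fun (w : Sample) (z : ℕ × BlockSite K) =>
      w (shiftSite (z.1 * K) (blockSite K z.2)) :=
    measurable_pi_lambda _ fun z => measurable_pi_apply _
  rw [← h3, ← h1]
  exact (Measure.map_map (MeasurableEquiv.curry ℕ (BlockSite K) Bool).measurable hm).symm

/-- The numbers of lines at the top sides of consecutive squares on the diagonal are independent,
because they are functions of disjoint sets of cells. -/
theorem sampleMeasure_blocks {D : ℕ} (hD : 0 < D) (t : unitInterval) (k : ℕ) (s : Finset ℕ)
    (T : ℕ → Set ℝ) :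
    sampleMeasure D t {w | ∀ q ∈ s, (gridX D (sampleV D w) (q * k) ((q + 1) * k) : ℝ) ∈ T q} =
      ∏ q ∈ s, sampleMeasure D t
        {w | (gridX D (sampleV D w) (q * k) ((q + 1) * k) : ℝ) ∈ T q} := by
  set U : ℕ → Set (BlockSite (k * D) → Bool) := fun q =>
    {u | (singleTop (k * D) (Function.extend (blockSite (k * D)) u fun _ => false) : ℝ) ∈ T q}
    with hU
  have hmem : ∀ (w : Sample) q, (gridX D (sampleV D w) (q * k) ((q + 1) * k) : ℝ) ∈ T q ↔
      (fun i => w (shiftSite (q * (k * D)) (blockSite (k * D) i))) ∈ U q := by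
    intro w q
    have := singleTop_extend (k * D) fun i => w (shiftSite (q * (k * D)) i)
    rw [hU, Set.mem_ofPred_eq, this, add_mul, one_mul, gridX_sampleV hD, mul_assoc]
  have hUm : ∀ q, MeasurableSet (U q) := fun q => (Set.toFinite _).measurableSet
  have key : ∀ s : Finset ℕ, sampleMeasure D t
      {w | ∀ q ∈ s, (gridX D (sampleV D w) (q * k) ((q + 1) * k) : ℝ) ∈ T q} =
      ∏ q ∈ s, Measure.infinitePi (fun i : BlockSite (k * D) => siteMeasure D t i) (U q) := by
    intro s
    rw [← Measure.infinitePi_pi _ fun q _ => hUm q, ← map_blocks_sampleMeasure,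
      Measure.map_apply (measurable_pi_lambda _ fun q => measurable_pi_lambda _ fun i =>
        measurable_pi_apply _) (MeasurableSet.pi s.countable_toSet fun q _ => hUm q)]
    refine congrArg _ (Set.ext fun w => ?_)
    simp only [Set.mem_ofPred_eq, Set.mem_preimage, Set.mem_pi, hmem, Finset.mem_coe]
  rw [key s]
  refine Finset.prod_congr rfl fun q _ => ?_
  simpa using (key {q}).symm

/-! ### Shifts of sequences of independent random variables -/

theorem measurePreserving_shift {X : Type*} [MeasurableSpace X] (μ : Measure X)
    [IsProbabilityMeasure μ] :
    MeasurePreserving (fun (y : ℕ → X) n => y (n + 1)) (Measure.infinitePi fun _ => μ)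
      (Measure.infinitePi fun _ => μ) :=
  ⟨measurable_pi_lambda _ fun n => measurable_pi_apply (n + 1),
    Measure.map_infinitePi_infinitePi_of_inj (P := fun _ : ℕ => μ) (add_left_injective 1)⟩

/-- The shift is ergodic for the law of a sequence of independent and identically distributed random
variables: an invariant set belongs to the tail σ-algebra. -/
theorem ergodic_shift {X : Type*} [MeasurableSpace X] (μ : Measure X) [IsProbabilityMeasure μ] :
    Ergodic (fun (y : ℕ → X) n => y (n + 1)) (Measure.infinitePi fun _ => μ) := by
  refine { measurePreserving_shift μ with aeconst_set := fun A hA hinv => ?_ }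
  have hind : iIndepFun (fun (n : ℕ) (y : ℕ → X) => y n) (Measure.infinitePi fun _ => μ) :=
    iIndepFun_infinitePi (X := fun _ x => x) fun _ => measurable_id
  have hiter : ∀ n, (fun (y : ℕ → X) i => y (n + i)) ⁻¹' A = A := by
    intro n
    induction n with
    | zero => simp
    | succ n ih =>
      conv_rhs => rw [← hinv, ← ih]
      ext y
      simp only [Set.mem_preimage, add_right_comm, add_assoc]
  have htail : MeasurableSet[Filter.limsup
      (fun n => MeasurableSpace.comap (fun y : ℕ → X => y n) inferInstance) Filter.atTop] A := by
    rw [Filter.limsup_eq_iInf_iSup_of_nat, MeasurableSpace.measurableSet_iInf]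
    intro n
    rw [← hiter n]
    have hm : Measurable[⨆ i ≥ n, MeasurableSpace.comap (fun y : ℕ → X => y i) inferInstance]
        (fun (y : ℕ → X) i => y (n + i)) := by
      refine @measurable_pi_lambda _ _ _ (_) _ _ fun i => ?_
      exact (comap_measurable (fun y : ℕ → X => y (n + i))).mono
        (le_iSup₂ (f := fun i (_ : i ≥ n) =>
          MeasurableSpace.comap (fun y : ℕ → X => y i) inferInstance) (n + i)
          (Nat.le_add_right n i)) le_rfl
    exact hm hA
  have h01 := measure_zero_or_one_of_measurableSet_limsup_atTop
    (fun n => (measurable_pi_apply n).comap_le) hind.iIndep htail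
  rw [Filter.eventuallyConst_set']
  rcases h01 with h | h
  · exact Or.inl (ae_eq_empty.mpr h)
  · exact Or.inr (ae_eq_univ.mpr ((prob_compl_eq_zero_iff hA).mpr h))

/-! ### The process of the numbers of lines -/

section Laws

variable {Ω : Type*} [MeasurableSpace Ω] {P : Measure Ω} [IsProbabilityMeasure P]
  {t : unitInterval} {p : ℕ → Ω → ℝ × ℝ}
  {ξ : ℕ × ℕ → Ω → Finset ℤ → Finset ℤ → Finset ℤ × Finset ℤ}

theorem IsStepColored.ae_superadditive (h : IsStepColored P t p ξ) :
    ∀ᵐ ω ∂P, randX p ξ 0 0 ω = 0 ∧ ∀ m n : ℕ, m ≤ n →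
      randX p ξ 0 m ω + randX p ξ m n ω ≤ randX p ξ 0 n ω := by
  filter_upwards [h.ae_exists_outcome, ae_all_iff.mpr fun N => ae_exists_separated h.poisson N]
    with ω hξ hsep
  refine ⟨?_, fun m n hmn => ?_⟩
  · obtain ⟨M, hM⟩ := hsep 0
    have := hM.X_eq_gridX M.succ_pos hξ (m := 0) le_rfl
    unfold randX
    rw [this]
    simp [gridX]
  · obtain ⟨M, hM⟩ := hsep n
    exact hM.X_add_le M.succ_pos hξ hmn le_rfl

/-- Both sides are limits of the same sequence, since for the grid models the corner does not
matter. -/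
theorem IsStepColored.measure_corner_eq (h : IsStepColored P t p ξ) (m : ℕ) (s : Finset ℕ)
    (T : ℕ → Set ℝ) :
    P {ω | ∀ k ∈ s, randX p ξ m (m + k) ω ∈ T k} =
      P {ω | ∀ k ∈ s, randX p ξ 0 (0 + k) ω ∈ T k} := by
  have key : ∀ m, Filter.Tendsto (fun M : ℕ => sampleMeasure (M + 1) t
      {w | ∀ k ∈ s, (singleTop (k * (M + 1)) w : ℝ) ∈ T k}) Filter.atTop
        (nhds (P {ω | ∀ k ∈ s, randX p ξ m (m + k) ω ∈ T k})) := by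
    intro m
    have := h.tendsto_sampleMeasure (s.image fun k => (m, m + k)) fun r => T (r.2 - r.1)
    simp only [sampleMeasure_topEvent (Nat.succ_pos _), Finset.forall_mem_image,
      Nat.add_sub_cancel_left] at this
    exact this
  exact tendsto_nhds_unique (key m) (key 0)

theorem IsStepColored.identDistrib_corner (h : IsStepColored P t p ξ) (m : ℕ) :
    IdentDistrib (fun ω (k : ℕ) => randX p ξ m (m + k) ω) (fun ω (k : ℕ) => randX p ξ 0 (0 + k) ω)
      P P := by
  have hX : ∀ m, AEMeasurable (fun ω (k : ℕ) => randX p ξ m (m + k) ω) P := fun m =>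
    aemeasurable_pi_lambda _ fun k => h.aemeasurable_randX m (m + k)
  refine ⟨hX m, hX 0, ?_⟩
  have := fun m => Measure.isProbabilityMeasure_map (hX m)
  refine ext_of_generate_finite _
    (generateFrom_squareCylinders (α := fun _ : ℕ => ℝ)).symm
    (isPiSystem_squareCylinders (fun _ => MeasurableSpace.isPiSystem_measurableSet)
      (by simp)) ?_ ?_
  · rintro _ ⟨s, T, hT, rfl⟩
    have hS : MeasurableSet (Set.pi s T) :=
      MeasurableSet.pi s.countable_toSet fun k _ => hT k (Set.mem_univ k)
    rw [Measure.map_apply_of_aemeasurable (hX m) hS, Measure.map_apply_of_aemeasurable (hX 0) hS]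
    exact h.measure_corner_eq m s T
  · rw [measure_univ, measure_univ]

/-- The numbers of lines at the top sides of consecutive squares on the diagonal are independent. -/
theorem IsStepColored.measure_blocks_eq (h : IsStepColored P t p ξ) {k : ℕ} (hk : 0 < k)
    (s : Finset ℕ) (T : ℕ → Set ℝ) :
    P {ω | ∀ q ∈ s, randX p ξ (q * k) ((q + 1) * k) ω ∈ T q} =
      ∏ q ∈ s, P {ω | randX p ξ (q * k) ((q + 1) * k) ω ∈ T q} := by
  have key : ∀ s : Finset ℕ, Filter.Tendsto (fun M : ℕ => sampleMeasure (M + 1) t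
      {w | ∀ q ∈ s, (gridX (M + 1) (sampleV (M + 1) w) (q * k) ((q + 1) * k) : ℝ) ∈ T q})
        Filter.atTop (nhds (P {ω | ∀ q ∈ s, randX p ξ (q * k) ((q + 1) * k) ω ∈ T q})) := by
    intro s
    have := h.tendsto_sampleMeasure (s.image fun q => (q * k, (q + 1) * k)) fun r => T (r.1 / k)
    simp only [topEvent, Finset.forall_mem_image, Nat.mul_div_cancel _ hk] at this
    exact this
  have hlim := key s
  simp only [sampleMeasure_blocks (Nat.succ_pos _)] at hlim
  refine tendsto_nhds_unique hlim (ENNReal.tendsto_finsetProd_of_ne_top s (fun q _ => ?_)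
    fun q _ => measure_ne_top _ _)
  simpa using key {q}

theorem IsStepColored.isErgodicProcess_blocks (h : IsStepColored P t p ξ) {k : ℕ} (hk : 1 ≤ k) :
    IsErgodicProcess P fun n => randX p ξ (n * k) ((n + 1) * k) := by
  have hX : ∀ n, AEMeasurable (randX p ξ (n * k) ((n + 1) * k)) P := fun n =>
    h.aemeasurable_randX _ _
  refine ⟨hX, ?_⟩
  have hprob := fun n => Measure.isProbabilityMeasure_map (hX n)
  have hmap : ∀ n, P.map (randX p ξ (n * k) ((n + 1) * k)) =
      P.map (randX p ξ (0 * k) ((0 + 1) * k)) := by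
    have : ∀ n, P.map (randX p ξ (n * k) ((n + 1) * k)) = P.map (randX p ξ 0 (0 + k)) := by
      intro n
      have := ((h.identDistrib_corner (n * k)).comp (measurable_pi_apply k)).map_eq
      rw [add_mul, one_mul]
      exact this
    exact fun n => (this n).trans (this 0).symm
  have hlaw : P.map (fun ω n => randX p ξ (n * k) ((n + 1) * k) ω) =
      Measure.infinitePi fun _ => P.map (randX p ξ (0 * k) ((0 + 1) * k)) := by
    refine Measure.eq_infinitePi _ fun s T hT => ?_
    rw [Measure.map_apply_of_aemeasurable (aemeasurable_pi_lambda _ hX)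
      (MeasurableSet.pi s.countable_toSet fun q _ => hT q)]
    refine (h.measure_blocks_eq hk s T).trans (Finset.prod_congr rfl fun q _ => ?_)
    rw [← hmap q, Measure.map_apply_of_aemeasurable (hX q) (hT q)]
    rfl
  rw [hlaw]
  exact ergodic_shift _

end Laws

end TPNG

theorem mainTheorem11 {Ω : Type*} [MeasurableSpace Ω] (P : Measure Ω) [IsProbabilityMeasure P]
    (t : ℝ) (ht0 : 0 ≤ t) (ht1 : t < 1)
    (p : ℕ → Ω → ℝ × ℝ) (ξ : ℕ × ℕ → Ω → Finset ℤ → Finset ℤ → Finset ℤ × Finset ℤ)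
    (hmodel : TPNG.IsStepColored P t p ξ) :
    -- the `X_{m,n}` are random variables
    (∀ m n : ℕ, m ≤ n → AEMeasurable (TPNG.randX p ξ m n) P) ∧
    -- superadditivity
    (∀ᵐ ω ∂P, TPNG.randX p ξ 0 0 ω = 0 ∧ ∀ m n : ℕ, m ≤ n →
      TPNG.randX p ξ 0 m ω + TPNG.randX p ξ m n ω ≤ TPNG.randX p ξ 0 n ω) ∧
    -- ergodicity along the diagonal blocks; the index `n` here is `n - 1` of the usual indexing
    (∀ k : ℕ, 1 ≤ k →
      TPNG.IsErgodicProcess P fun n => TPNG.randX p ξ (n * k) ((n + 1) * k)) ∧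
    -- stationarity
    (∀ m : ℕ, IdentDistrib (fun ω (k : ℕ) => TPNG.randX p ξ m (m + k) ω)
      (fun ω (k : ℕ) => TPNG.randX p ξ (m + 1) (m + k + 1) ω) P P) ∧
    -- integrability of the negative part
    Integrable (fun ω => max (-TPNG.randX p ξ 0 1 ω) 0) P := by
  have h : TPNG.IsStepColored P (⟨t, ht0, ht1.le⟩ : unitInterval) p ξ := hmodel
  refine ⟨fun m n _ => h.aemeasurable_randX m n, h.ae_superadditive,
    fun k hk => h.isErgodicProcess_blocks hk, fun m => ?_, ?_⟩
  · have hshift := (h.identDistrib_corner m).trans (h.identDistrib_corner (m + 1)).symm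
    simp only [add_right_comm m 1] at hshift
    exact hshift
  · have hzero : (fun ω => max (-TPNG.randX p ξ 0 1 ω) 0) = fun _ => 0 := by
      funext ω
      refine max_eq_right (neg_nonpos.mpr ?_)
      exact finsum_nonneg fun i => finsum_nonneg fun _ => Nat.cast_nonneg _
    rw [hzero]
    exact integrable_zero _ _ _
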